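/- \textbf{Proposition (Partial orthogonality in $H^{1/2}(\mathbb{R})$).} For $n\in\mathbb{N}_0$ let $T_n$, $U_n$ be the Chebyshev polynomials of the first and second kind, and for $x\in\mathbb{R}$ let $$\tilde T_n(x)=\begin{cases}T_n(x)&|x|\le 1,\\ (x-\operatorname{sgn}(x)\sqrt{x^2-1})^n&|x|>1,\end{cases}\qquad W_n(x)=(1-x^2)_+^{1/2}\,U_n(x),$$ where $(1-x^2)_+^{1/2}=0$ for $|x|\ge 1$. For $0<s<1$ let $$(-\Delta)^{s}u(x)=c_s\,\mathrm{p.v.}\!\int_{\mathbb{R}}\frac{u(x)-u(y)}{|x-y|^{1+2s}}\,\mathrm{d}y,\qquad c_s=\frac{4^s\,\Gamma(1/2+s)}{\pi^{1/2}\,|\Gamma(-s)|},$$ where $\mathrm{p.v.}\int_{\mathbb{R}}=\lim_{\varepsilon\downarrow0}\int_{|x-y|>\varepsilon}$, and let $\langle f,g\rangle_{L^2(\mathbb{R})}=\int_{\mathbb{R}}fg\,\mathrm{d}x$. Then for every $n\ge1$ and $m\ge0$ the principal values that define $(-\Delta)^{1/4}\tilde T_n(x)$ and $(-\Delta)^{1/4}W_m(x)$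 exist for a.e. $x\in\mathbb{R}$, the functions $(-\Delta)^{1/4}\tilde T_n$ and $(-\Delta)^{1/4}W_m$ belong to $L^2(\mathbb{R})$, and $$\langle(-\Delta)^{1/4}\tilde T_j,(-\Delta)^{1/4}\tilde T_l\rangle_{L^2(\mathbb{R})}=\frac{\pi}{2}\,l\,\delta_{jl}\qquad(j,l\ge1),$$ $$\langle(-\Delta)^{1/4}W_j,(-\Delta)^{1/4}W_l\rangle_{L^2(\mathbb{R})}=\frac{\pi}{2}\,(l+1)\,\delta_{jl}\qquad(j,l\ge0),$$ where $\delta_{jl}$ is the Kronecker delta. -/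

import Mathlib

open MeasureTheory Filter Topology

noncomputable section

/-- The extended Chebyshev function of the first kind: the Chebyshev polynomial `T_n` on
`[-1,1]`, continued by `(x - sgn(x) √(x² - 1))^n` for `|x| > 1`. -/
def extChebyshevT (n : ℕ) (x : ℝ) : ℝ :=
  if |x| ≤ 1 then (Polynomial.Chebyshev.T ℝ (n : ℤ)).eval x
  else (x - Real.sign x * Real.sqrt (x ^ 2 - 1)) ^ n

/-- The weighted Chebyshev polynomial of the second kind `(1 - x²)₊^{1/2} U_n(x)`,
extended by zero to the whole line. -/
def weightedChebyshevU (n : ℕ) (x : ℝ) : ℝ :=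
  Real.sqrt (max (1 - x ^ 2) 0) * (Polynomial.Chebyshev.U ℝ (n : ℤ)).eval x

/-- The normalising constant of the one-dimensional fractional Laplacian of order `s`,
`0 < s < 1`. -/
def fracLapConst (s : ℝ) : ℝ :=
  4 ^ s * Real.Gamma (1 / 2 + s) / (Real.sqrt Real.pi * |Real.Gamma (-s)|)

/-- The integrand of the singular integral that defines `(-Δ)^s u` at `x`. -/
def fracLapIntegrand (s : ℝ) (u : ℝ → ℝ) (x y : ℝ) : ℝ :=
  (u x - u y) / |x - y| ^ (1 + 2 * s)

/-- The singular integral truncated at distance `ε` from the singularity. -/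
def fracLapTrunc (s : ℝ) (u : ℝ → ℝ) (x ε : ℝ) : ℝ :=
  fracLapConst s * ∫ y in {y : ℝ | ε < |x - y|}, fracLapIntegrand s u x y

/-- The Cauchy principal value that defines `(-Δ)^s u` exists at `x`: every truncated integral
converges absolutely, and the truncated integrals have a finite limit as `ε ↓ 0`. -/
def FracLapExistsAt (s : ℝ) (u : ℝ → ℝ) (x : ℝ) : Prop :=
  (∀ ε : ℝ, 0 < ε → IntegrableOn (fracLapIntegrand s u x) {y : ℝ | ε < |x - y|}) ∧
    ∃ L : ℝ, Tendsto (fracLapTrunc s u x) (𝓝[>] 0) (𝓝 L)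

/-- The fractional Laplacian `(-Δ)^s u`, as a principal value singular integral
(meaningful at the points where `FracLapExistsAt s u x` holds). -/
def fracLap (s : ℝ) (u : ℝ → ℝ) (x : ℝ) : ℝ :=
  limUnder (𝓝[>] (0 : ℝ)) (fracLapTrunc s u x)

end

/-!
The two Chebyshev systems are the real and imaginary parts of the boundary values of one holomorphic
function. Let `w` be the inverse of the Joukowski map `w ↦ (w + w⁻¹) / 2` that takes the upper
half-plane into the unit disc (`joukowskiInv`). On the real line
`w ^ n = T̃_n - i W_{n-1}` for `n ≥ 1` (`Complex.joukowskiInv_pow_ofReal`).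

For boundary values of a bounded holomorphic function `F`, the singular integral splits into two
integrals along the horizontal rays from `x`. Cauchy's theorem rotates both onto the vertical ray,
where the phases combine to the factor `√2` (`Complex.integral_rayQuotient_one_add_neg_one`), and an
integration by parts turns the result into the half-derivative
`G(x) = -i π^{-1/2} ∫₀^∞ F'(x + it) t^{-1/2} dt`. Away from `±1` the boundary function is locally
Lipschitz, so all integrals converge absolutely (`Complex.fracLap_of_joukowskiInv_pow`).

Write `G_n` for the half-derivative of `w ^ n` and `D_n` for the derivative of `w ^ n`. By Fubini,
the pairing of `G_j` with `G_l` is `π⁻¹ ∬ (s t)^{-1/2} P(s, t) ds dt`, with `P(s, t)` the pairing of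
`D_j` on the line at height `s` with `D_l` on the line at height `t`.
* For the bilinear pairing, shifting the contour upwards gives `P = 0`, so `∫ G_j G_l = 0`
  (`Complex.integral_joukowskiHalfDeriv_mul_joukowskiHalfDeriv`).
* For the sesquilinear pairing, shifting the contour shows that `P(s, t) = Φ(s + t)`
  (`Complex.integral_joukowskiInvPowDeriv_mul_conj`). The double integral is then
  `B(1/2, 1/2) ∫ Φ = π ∫ Φ` (`integral_quadrant_rpow_mul_add`), and `∫ Φ = ∫ D_j · conj(i w ^ l) dx`,
  whose real part is `j ∫_{-1}^1 T_{j-l}(x) (1 - x²)^{-1/2} dx = j π δ_{jl}`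
  (`Complex.re_integral_joukowskiPairing`).

The real parts of the two identities are the difference and the sum of the inner products for the
two systems, so each of these equals `(π / 2) l δ_{jl}`.
-/

noncomputable section

/-! ### The inverse Joukowski map on the closed upper half-plane -/

/-- The branch of the square root of `-iz` that is holomorphic in the upper half-plane and
continuous up to the real line. -/
def upSqrt (z : ℂ) : ℂ := (-Complex.I * z) ^ (1 / 2 : ℂ)

/-- The branch of `√(1 - z²)` on the closed upper half-plane that is positive on `(-1,1)`. -/
def joukowskiRoot (z : ℂ) : ℂ := upSqrt (z - 1) * upSqrt (z + 1)

/-- The inverse `w` of the Joukowski map `w ↦ (w + w⁻¹) / 2` that takes the upper half-plane into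
the unit disc. -/
def joukowskiInv (z : ℂ) : ℂ := z - Complex.I * joukowskiRoot z

/-- The derivative of `joukowskiInv ^ n` on the closed upper half-plane without `±1`; at the branch
points `±1` the quotient takes the junk value `0`. -/
def joukowskiInvPowDeriv (n : ℕ) (z : ℂ) : ℂ :=
  Complex.I * n * joukowskiInv z ^ n / joukowskiRoot z

namespace Complex

lemma upSqrt_sq (z : ℂ) : upSqrt z ^ 2 = -I * z := by
  rw [upSqrt, ← cpow_mul_nat]; norm_num

lemma norm_upSqrt (z : ℂ) : ‖upSqrt z‖ = √‖z‖ := by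
  have h : ‖upSqrt z‖ ^ 2 = ‖z‖ := by rw [← norm_pow, upSqrt_sq]; simp
  rw [← h, Real.sqrt_sq (norm_nonneg _)]

lemma upSqrt_ne_zero {z : ℂ} (hz : z ≠ 0) : upSqrt z ≠ 0 := by
  intro h
  have := upSqrt_sq z
  simp [h, hz] at this

lemma upSqrt_re_nonneg (z : ℂ) : 0 ≤ (upSqrt z).re := by
  rcases eq_or_ne (-I * z) 0 with h | h
  · simp [upSqrt, h]
  rw [upSqrt, cpow_def_of_ne_zero h, exp_re]
  refine mul_nonneg (Real.exp_pos _).le (Real.cos_nonneg_of_mem_Icc ⟨?_, ?_⟩) <;>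
  · have h1 := neg_pi_lt_arg (-I * z)
    have h2 := arg_le_pi (-I * z)
    simp only [one_div, mul_im, log_im, inv_re, inv_im, re_ofNat, im_ofNat, normSq_ofNat]
    norm_num [← neg_mul]
    linarith

/-- The square root of a point of the closed right half-plane has argument at most `π / 4`. -/
lemma abs_upSqrt_im_le {z : ℂ} (hz : 0 ≤ z.im) : |(upSqrt z).im| ≤ (upSqrt z).re := by
  have h := congrArg re (upSqrt_sq z)
  simp [sq] at h
  exact abs_le_of_sq_le_sq (by nlinarith) (upSqrt_re_nonneg z)

lemma neg_I_mul_mem_slitPlane {z : ℂ} (hz : 0 ≤ z.im) (h0 : z ≠ 0) : -I * z ∈ slitPlane := by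
  rw [mem_slitPlane_iff]
  rcases hz.lt_or_eq with h | h
  · left; simpa using h
  · right
    simp
    intro h'
    exact h0 (Complex.ext h' h.symm)

lemma hasDerivAt_upSqrt {z : ℂ} (hz : 0 ≤ z.im) (h0 : z ≠ 0) :
    HasDerivAt upSqrt (-I / (2 * upSqrt z)) z := by
  have h := ((hasDerivAt_id z).const_mul (-I)).cpow_const (c := (1 / 2 : ℂ))
    (neg_I_mul_mem_slitPlane hz h0)
  have h1 : upSqrt z ≠ 0 := upSqrt_ne_zero h0
  have h2 : (-I * z) ^ ((1 / 2 : ℂ) - 1) = (upSqrt z)⁻¹ := by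
    rw [upSqrt, ← cpow_neg]; norm_num
  refine h.congr_deriv ?_
  simp only [id]
  rw [h2]
  field_simp

lemma continuousOn_upSqrt : ContinuousOn upSqrt {z | 0 ≤ z.im} := by
  intro z hz
  rcases eq_or_ne z 0 with rfl | h0
  · have : Tendsto upSqrt (𝓝 0) (𝓝 0) := by
      rw [tendsto_zero_iff_norm_tendsto_zero]
      simp_rw [norm_upSqrt]
      have : Continuous fun z : ℂ => √‖z‖ := by fun_prop
      simpa using this.tendsto 0
    have h0 : upSqrt 0 = 0 := by simp [upSqrt]
    exact ContinuousAt.continuousWithinAt (by rwa [ContinuousAt, h0])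
  · exact (hasDerivAt_upSqrt hz h0).continuousAt.continuousWithinAt

lemma measurable_upSqrt : Measurable upSqrt := by
  unfold upSqrt; fun_prop

/-- Among the two square roots the branch is singled out by a positive real part. -/
lemma upSqrt_eq_of_sq_eq {z u : ℂ} (h : u ^ 2 = -I * z) (hu : 0 < u.re) : upSqrt z = u := by
  have h1 : (upSqrt z - u) * (upSqrt z + u) = 0 := by
    linear_combination upSqrt_sq z - h
  rcases mul_eq_zero.1 h1 with h2 | h2
  · exact sub_eq_zero.1 h2
  · have h3 := congrArg re h2
    have h4 := upSqrt_re_nonneg z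
    simp only [add_re, zero_re] at h3
    linarith

lemma upSqrt_ofReal_of_nonneg {x : ℝ} (hx : 0 ≤ x) : upSqrt x = √(x / 2) * (1 - I) := by
  rcases hx.eq_or_lt with rfl | h
  · simp [upSqrt]
  refine upSqrt_eq_of_sq_eq ?_ ?_
  · have h1 : ((√(x / 2) : ℝ) : ℂ) ^ 2 = x / 2 := by
      rw [← ofReal_pow, Real.sq_sqrt (by positivity)]; push_cast; rfl
    linear_combination (1 - I) ^ 2 * h1 + (x / 2 : ℂ) * I_sq
  · simp; positivity

lemma upSqrt_ofReal_of_nonpos {x : ℝ} (hx : x ≤ 0) : upSqrt x = √(-x / 2) * (1 + I) := by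
  rcases hx.eq_or_lt with rfl | h
  · simp [upSqrt]
  have h2 : 0 < -x := by linarith
  refine upSqrt_eq_of_sq_eq ?_ ?_
  · have h1 : ((√(-x / 2) : ℝ) : ℂ) ^ 2 = -x / 2 := by
      rw [← ofReal_pow, Real.sq_sqrt (by positivity)]; push_cast; rfl
    linear_combination (1 + I) ^ 2 * h1 + (-x / 2 : ℂ) * I_sq
  · simpa using h

lemma joukowskiRoot_sq (z : ℂ) : joukowskiRoot z ^ 2 = 1 - z ^ 2 := by
  rw [joukowskiRoot, mul_pow, upSqrt_sq, upSqrt_sq]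
  linear_combination (z ^ 2 - 1) * I_sq

lemma norm_joukowskiRoot (z : ℂ) : ‖joukowskiRoot z‖ = √(‖z - 1‖ * ‖z + 1‖) := by
  rw [joukowskiRoot, norm_mul, norm_upSqrt, norm_upSqrt, Real.sqrt_mul (norm_nonneg _)]

lemma joukowskiRoot_ne_zero {z : ℂ} (h1 : z ≠ 1) (h2 : z ≠ -1) : joukowskiRoot z ≠ 0 :=
  mul_ne_zero (upSqrt_ne_zero (sub_ne_zero.2 h1))
    (upSqrt_ne_zero (by rwa [← sub_neg_eq_add, sub_ne_zero]))

lemma joukowskiInv_eq_sq (z : ℂ) :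
    joukowskiInv z = I / 2 * (upSqrt (z - 1) - upSqrt (z + 1)) ^ 2 := by
  rw [joukowskiInv, joukowskiRoot]
  linear_combination (-I / 2) * upSqrt_sq (z - 1) + (-I / 2) * upSqrt_sq (z + 1) + z * I_sq

/-- The two roots of `w ^ 2 - 2 z w + 1 = 0` have product `1`. -/
lemma joukowskiInv_mul_conjugate (z : ℂ) :
    joukowskiInv z * (z + I * joukowskiRoot z) = 1 := by
  rw [joukowskiInv]
  linear_combination joukowskiRoot_sq z - joukowskiRoot z ^ 2 * I_sq

lemma joukowskiInv_ne_zero (z : ℂ) : joukowskiInv z ≠ 0 :=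
  left_ne_zero_of_mul_eq_one (joukowskiInv_mul_conjugate z)

lemma joukowskiInv_add_inv (z : ℂ) : joukowskiInv z + (joukowskiInv z)⁻¹ = 2 * z := by
  rw [inv_eq_of_mul_eq_one_right (joukowskiInv_mul_conjugate z), joukowskiInv]
  ring

/-- With `a = √(-i(z-1))` and `b = √(-i(z+1))`, both of argument at most `π / 4` in absolute value,
`w = i (a - b)² / 2` and `w⁻¹ = i (a + b)² / 2`, and `|a - b| ≤ |a + b|`. -/
lemma norm_joukowskiInv_le_one {z : ℂ} (hz : 0 ≤ z.im) : ‖joukowskiInv z‖ ≤ 1 := by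
  set a := upSqrt (z - 1) with ha
  set b := upSqrt (z + 1) with hb
  have hprod : (a - b) * (a + b) = 2 * I := by
    linear_combination upSqrt_sq (z - 1) - upSqrt_sq (z + 1)
  have hle : ‖a - b‖ ^ 2 ≤ ‖a + b‖ ^ 2 := by
    have h1 : |a.im| ≤ a.re := abs_upSqrt_im_le (by simpa using hz)
    have h2 : |b.im| ≤ b.re := abs_upSqrt_im_le (by simpa using hz)
    rw [Complex.sq_norm, Complex.sq_norm, normSq_apply, normSq_apply]
    simp only [sub_re, sub_im, add_re, add_im]
    have h3 : |a.im| * |b.im| ≤ a.re * b.re :=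
      mul_le_mul h1 h2 (abs_nonneg _) ((abs_nonneg _).trans h1)
    rw [← abs_mul] at h3
    nlinarith [neg_abs_le (a.im * b.im)]
  have hle' : ‖a - b‖ ≤ ‖a + b‖ :=
    (sq_le_sq₀ (norm_nonneg _) (norm_nonneg _)).1 hle
  have h2 : ‖a - b‖ * ‖a + b‖ = 2 := by rw [← norm_mul, hprod]; simp
  rw [joukowskiInv_eq_sq, norm_mul, norm_pow]
  simp only [norm_div, norm_I, Complex.norm_ofNat]
  nlinarith [norm_nonneg (a - b)]

lemma norm_joukowskiInv_mul_norm_le_one {z : ℂ} (hz : 0 ≤ z.im) : ‖joukowskiInv z‖ * ‖z‖ ≤ 1 := by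
  have h := joukowskiInv_add_inv z
  have hw := norm_joukowskiInv_le_one hz
  have h1 : joukowskiInv z * (2 * z) = joukowskiInv z ^ 2 + 1 := by
    rw [← h, mul_add, mul_inv_cancel₀ (joukowskiInv_ne_zero z), sq]
  have h2 : ‖joukowskiInv z‖ * (2 * ‖z‖) ≤ ‖joukowskiInv z‖ ^ 2 + 1 := by
    calc _ = ‖joukowskiInv z * (2 * z)‖ := by simp
      _ ≤ _ := by rw [h1]; exact (norm_add_le _ _).trans (by simp)
  nlinarith [norm_nonneg (joukowskiInv z)]

lemma continuousOn_joukowskiRoot : ContinuousOn joukowskiRoot {z | 0 ≤ z.im} :=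
  (continuousOn_upSqrt.comp (by fun_prop) (fun z hz => by simpa using hz)).mul
    (continuousOn_upSqrt.comp (by fun_prop) (fun z hz => by simpa using hz))

lemma continuousOn_joukowskiInv : ContinuousOn joukowskiInv {z | 0 ≤ z.im} :=
  continuousOn_id.sub (continuousOn_const.mul continuousOn_joukowskiRoot)

lemma measurable_joukowskiRoot : Measurable joukowskiRoot :=
  (measurable_upSqrt.comp (by fun_prop)).mul (measurable_upSqrt.comp (by fun_prop))

lemma measurable_joukowskiInv : Measurable joukowskiInv :=
  measurable_id.sub (measurable_joukowskiRoot.const_mul _)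

lemma measurable_joukowskiInvPowDeriv (n : ℕ) : Measurable (joukowskiInvPowDeriv n) :=
  ((measurable_joukowskiInv.pow_const n).const_mul _).div measurable_joukowskiRoot

lemma hasDerivAt_joukowskiRoot {z : ℂ} (hz : 0 ≤ z.im) (h1 : z ≠ 1) (h2 : z ≠ -1) :
    HasDerivAt joukowskiRoot (-z / joukowskiRoot z) z := by
  have h1' : z - 1 ≠ 0 := sub_ne_zero.2 h1
  have h2' : z + 1 ≠ 0 := by rwa [← sub_neg_eq_add, sub_ne_zero]
  have ha := (hasDerivAt_upSqrt (z := z - 1) (by simpa using hz) h1').comp z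
    ((hasDerivAt_id z).sub_const 1)
  have hb := (hasDerivAt_upSqrt (z := z + 1) (by simpa using hz) h2').comp z
    ((hasDerivAt_id z).add_const 1)
  refine (ha.mul hb).congr_deriv ?_
  have h3 := upSqrt_ne_zero h1'
  have h4 := upSqrt_ne_zero h2'
  simp only [joukowskiRoot, Function.comp, id]
  field_simp
  linear_combination (-I) * upSqrt_sq (z - 1) + (-I) * upSqrt_sq (z + 1) + (2 * z) * I_sq

lemma hasDerivAt_joukowskiInv {z : ℂ} (hz : 0 ≤ z.im) (h1 : z ≠ 1) (h2 : z ≠ -1) :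
    HasDerivAt joukowskiInv (I * joukowskiInv z / joukowskiRoot z) z := by
  refine ((hasDerivAt_id z).sub ((hasDerivAt_joukowskiRoot hz h1 h2).const_mul I)).congr_deriv ?_
  have := joukowskiRoot_ne_zero h1 h2
  rw [joukowskiInv]
  field_simp
  linear_combination joukowskiRoot z * I_sq

lemma hasDerivAt_joukowskiInv_pow (n : ℕ) {z : ℂ} (hz : 0 ≤ z.im) (h1 : z ≠ 1) (h2 : z ≠ -1) :
    HasDerivAt (fun z => joukowskiInv z ^ n) (joukowskiInvPowDeriv n z) z := by
  refine ((hasDerivAt_joukowskiInv hz h1 h2).pow n).congr_deriv ?_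
  rw [joukowskiInvPowDeriv]
  rcases n with _ | n
  · simp
  · simp [pow_succ]; ring

lemma differentiableAt_joukowskiInvPowDeriv (n : ℕ) {z : ℂ} (hz : 0 ≤ z.im) (h1 : z ≠ 1)
    (h2 : z ≠ -1) : DifferentiableAt ℂ (joukowskiInvPowDeriv n) z :=
  ((hasDerivAt_joukowskiInv_pow n hz h1 h2).differentiableAt.const_mul _).div
    (hasDerivAt_joukowskiRoot hz h1 h2).differentiableAt (joukowskiRoot_ne_zero h1 h2)

lemma joukowskiRoot_ofReal_of_abs_le_one {x : ℝ} (hx : |x| ≤ 1) :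
    joukowskiRoot x = √(1 - x ^ 2) := by
  obtain ⟨h1, h2⟩ := abs_le.1 hx
  have e1 : ((x : ℂ) - 1) = ((x - 1 : ℝ) : ℂ) := by push_cast; rfl
  have e2 : ((x : ℂ) + 1) = ((x + 1 : ℝ) : ℂ) := by push_cast; rfl
  rw [joukowskiRoot, e1, e2, upSqrt_ofReal_of_nonpos (by linarith),
    upSqrt_ofReal_of_nonneg (by linarith)]
  have : √(1 - x ^ 2) = √(-(x - 1) / 2) * √((x + 1) / 2) * 2 := by
    rw [← Real.sqrt_mul (by linarith), Real.sqrt_eq_iff_mul_self_eq (by nlinarith) (by positivity)]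
    have := Real.mul_self_sqrt (show 0 ≤ -(x - 1) / 2 * ((x + 1) / 2) by nlinarith)
    linear_combination -4 * this
  rw [this]; push_cast
  linear_combination (-(√(-(x - 1) / 2) : ℂ) * √((x + 1) / 2)) * I_sq

/-- Outside `[-1,1]` the boundary values of the root are imaginary, with opposite signs on the two
sides. -/
lemma joukowskiRoot_ofReal_of_one_le {x : ℝ} (hx : 1 ≤ x) :
    joukowskiRoot x = -I * √(x ^ 2 - 1) := by
  have e1 : ((x : ℂ) - 1) = ((x - 1 : ℝ) : ℂ) := by push_cast; rfl
  have e2 : ((x : ℂ) + 1) = ((x + 1 : ℝ) : ℂ) := by push_cast; rfl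
  rw [joukowskiRoot, e1, e2, upSqrt_ofReal_of_nonneg (by linarith),
    upSqrt_ofReal_of_nonneg (by linarith)]
  have : √(x ^ 2 - 1) = √((x - 1) / 2) * √((x + 1) / 2) * 2 := by
    rw [← Real.sqrt_mul (by linarith), Real.sqrt_eq_iff_mul_self_eq (by nlinarith) (by positivity)]
    have := Real.mul_self_sqrt (show 0 ≤ (x - 1) / 2 * ((x + 1) / 2) by nlinarith)
    linear_combination -4 * this
  rw [this]; push_cast
  linear_combination ((√((x - 1) / 2) : ℂ) * √((x + 1) / 2)) * I_sq

lemma joukowskiRoot_ofReal_of_le_neg_one {x : ℝ} (hx : x ≤ -1) :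
    joukowskiRoot x = I * √(x ^ 2 - 1) := by
  have e1 : ((x : ℂ) - 1) = ((x - 1 : ℝ) : ℂ) := by push_cast; rfl
  have e2 : ((x : ℂ) + 1) = ((x + 1 : ℝ) : ℂ) := by push_cast; rfl
  rw [joukowskiRoot, e1, e2, upSqrt_ofReal_of_nonpos (by linarith),
    upSqrt_ofReal_of_nonpos (by linarith)]
  have : √(x ^ 2 - 1) = √(-(x - 1) / 2) * √(-(x + 1) / 2) * 2 := by
    rw [← Real.sqrt_mul (by linarith), Real.sqrt_eq_iff_mul_self_eq (by nlinarith) (by positivity)]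
    have := Real.mul_self_sqrt (show 0 ≤ -(x - 1) / 2 * (-(x + 1) / 2) by nlinarith)
    linear_combination -4 * this
  rw [this]; push_cast
  linear_combination ((√(-(x - 1) / 2) : ℂ) * √(-(x + 1) / 2)) * I_sq

lemma joukowskiInv_cos {θ : ℝ} (h0 : 0 ≤ θ) (hπ : θ ≤ Real.pi) :
    joukowskiInv (Real.cos θ : ℝ) = exp (-(θ * I)) := by
  rw [joukowskiInv, joukowskiRoot_ofReal_of_abs_le_one (Real.abs_cos_le_one θ),
    ← Real.sin_eq_sqrt_one_sub_cos_sq h0 hπ, exp_neg, exp_mul_I, ← ofReal_cos, ← ofReal_sin]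
  refine eq_inv_of_mul_eq_one_left ?_
  have : ((Real.cos θ : ℂ)) ^ 2 + (Real.sin θ : ℂ) ^ 2 = 1 := by
    exact_mod_cast Real.cos_sq_add_sin_sq θ
  linear_combination this - (Real.sin θ : ℂ) ^ 2 * I_sq

/-- The two Chebyshev systems are the real and imaginary parts of the boundary values of one
bounded holomorphic function. -/
lemma joukowskiInv_pow_ofReal (n : ℕ) (x : ℝ) :
    joukowskiInv x ^ (n + 1) = extChebyshevT (n + 1) x - I * weightedChebyshevU n x := by
  rcases le_or_gt |x| 1 with hx | hx
  · obtain ⟨h1, h2⟩ := abs_le.1 hx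
    obtain ⟨θ, ⟨h0, hπ⟩, rfl⟩ : ∃ θ ∈ Set.Icc 0 Real.pi, Real.cos θ = x :=
      ⟨Real.arccos x, ⟨Real.arccos_nonneg x, Real.arccos_le_pi x⟩, Real.cos_arccos h1 h2⟩
    rw [joukowskiInv_cos h0 hπ, extChebyshevT, if_pos hx, weightedChebyshevU,
      Polynomial.Chebyshev.T_real_cos, max_eq_left (by nlinarith [Real.cos_sq_add_sin_sq θ]),
      ← Real.sin_eq_sqrt_one_sub_cos_sq h0 hπ, mul_comm (Real.sin θ),
      Polynomial.Chebyshev.U_real_cos, ← exp_nat_mul]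
    have : ((n + 1 : ℕ) : ℂ) * -(θ * I) = -(((n + 1 : ℝ) * θ : ℝ) : ℂ) * I := by push_cast; ring
    rw [this, exp_mul_I, cos_neg, sin_neg, ← ofReal_cos, ← ofReal_sin]
    push_cast
    ring
  · have hW : weightedChebyshevU n x = 0 := by
      have : 1 ≤ x ^ 2 := (one_lt_sq_iff_one_lt_abs x).2 hx |>.le
      rw [weightedChebyshevU, max_eq_right (by linarith)]; simp
    rw [hW, extChebyshevT, if_neg hx.not_ge]
    rcases lt_abs.1 hx with h | h
    · rw [joukowskiInv, joukowskiRoot_ofReal_of_one_le h.le, Real.sign_of_pos (by linarith)]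
      push_cast
      rw [show (x : ℂ) - I * (-I * √(x ^ 2 - 1)) = x - 1 * √(x ^ 2 - 1) by
        linear_combination (√(x ^ 2 - 1) : ℂ) * I_sq]
      simp
    · rw [joukowskiInv, joukowskiRoot_ofReal_of_le_neg_one (by linarith),
        Real.sign_of_neg (by linarith)]
      push_cast
      rw [show (x : ℂ) - I * (I * √(x ^ 2 - 1)) = x - (-1) * √(x ^ 2 - 1) by
        linear_combination -(√(x ^ 2 - 1) : ℂ) * I_sq]
      simp

end Complex

/-! ### Contour shifts and rotation of rays -/

namespace Complex

/-- Shifting the line of integration across a horizontal strip. -/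
theorem integral_horizontal_line_eq {f : ℂ → ℂ} {a b : ℝ} (hab : a ≤ b) {φ : ℝ → ℝ}
    (hc : ContinuousOn f {z | a ≤ z.im ∧ z.im ≤ b})
    (hd : DifferentiableOn ℂ f {z | a < z.im ∧ z.im < b})
    (hφ : ∀ᶠ x : ℝ in cocompact ℝ, ∀ y ∈ Set.Icc a b, ‖f (x + y * I)‖ ≤ φ x)
    (hφ0 : Tendsto φ (cocompact ℝ) (𝓝 0))
    (ha : Integrable fun x : ℝ => f (x + a * I)) (hb : Integrable fun x : ℝ => f (x + b * I)) :
    ∫ x : ℝ, f (x + a * I) = ∫ x : ℝ, f (x + b * I) := by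
  have hrect : ∀ R : ℝ, (∫ x : ℝ in -R..R, f (x + a * I)) - (∫ x : ℝ in -R..R, f (x + b * I)) =
      I * (∫ y : ℝ in a..b, f ((-R : ℝ) + y * I)) - I * (∫ y : ℝ in a..b, f (R + y * I)) := by
    intro R
    have h := integral_boundary_rect_eq_zero_of_continuousOn_of_differentiableOn f
      (⟨-R, a⟩ : ℂ) ⟨R, b⟩ (hc.mono ?_) (hd.mono ?_)
    · simp only [smul_eq_mul] at h
      linear_combination h
    · intro z hz
      have := hz.2
      simpa [Set.uIcc_of_le hab] using this
    · intro z hz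
      have := hz.2
      simpa [hab] using this
  have hvert : Tendsto (fun R : ℝ => ∫ y : ℝ in a..b, f (R + y * I)) (cocompact ℝ) (𝓝 0) := by
    have h0 : Tendsto (fun R => φ R * |b - a|) (cocompact ℝ) (𝓝 0) := by
      simpa using hφ0.mul_const |b - a|
    refine squeeze_zero_norm' ?_ h0
    filter_upwards [hφ] with R hR
    refine intervalIntegral.norm_integral_le_of_norm_le_const fun y hy => hR y ?_
    rw [Set.uIoc_of_le hab] at hy
    exact ⟨hy.1.le, hy.2⟩
  have hl := (intervalIntegral_tendsto_integral ha tendsto_neg_atTop_atBot tendsto_id).sub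
    (intervalIntegral_tendsto_integral hb tendsto_neg_atTop_atBot tendsto_id)
  have hr := ((hvert.comp ((tendsto_neg_atTop_atBot (G := ℝ)).mono_right
      atBot_le_cocompact)).const_mul I).sub
    ((hvert.comp (tendsto_id.mono_right atTop_le_cocompact)).const_mul I)
  have := tendsto_nhds_unique (hl.congr hrect) hr
  simpa [sub_eq_zero] using this

lemma integrableOn_rpow_mul_min {a : ℝ} (h1 : -1 < a) (h0 : a < 0) :
    IntegrableOn (fun t : ℝ => t ^ a * min 1 t⁻¹) (Set.Ioi 0) := by
  rw [← Set.Ioc_union_Ioi_eq_Ioi zero_le_one]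
  refine IntegrableOn.union ?_ ?_
  · have h : IntegrableOn (fun t : ℝ => t ^ a) (Set.Ioc 0 1) :=
      (intervalIntegrable_iff_integrableOn_Ioc_of_le zero_le_one).1
        (intervalIntegral.intervalIntegrable_rpow' h1)
    refine h.congr_fun (fun t ht => ?_) measurableSet_Ioc
    simp only
    rw [min_eq_left ((one_le_inv₀ ht.1).2 ht.2), mul_one]
  · have h : IntegrableOn (fun t : ℝ => t ^ (a - 1)) (Set.Ioi 1) :=
      integrableOn_Ioi_rpow_of_lt (by linarith) zero_lt_one
    refine h.congr_fun (fun t ht => ?_) measurableSet_Ioi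
    have ht0 : 0 < t := zero_lt_one.trans ht
    simp only
    rw [min_eq_right (inv_le_one_of_one_le₀ (le_of_lt ht)), Real.rpow_sub_one ht0.ne',
      div_eq_mul_inv]

lemma integral_Ioi_eq_integral_exp (g : ℝ → ℂ) :
    ∫ t in Set.Ioi 0, g t = ∫ τ : ℝ, Real.exp τ • g (Real.exp τ) := by
  have h := integral_image_eq_integral_abs_deriv_smul (s := Set.univ) MeasurableSet.univ
    (fun x _ => (Real.hasDerivAt_exp x).hasDerivWithinAt) Real.exp_injective.injOn g
  rw [Set.image_univ, Real.range_exp, setIntegral_univ] at h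
  simpa using h

lemma integrable_exp_smul_iff {g : ℝ → ℂ} :
    Integrable (fun τ : ℝ => Real.exp τ • g (Real.exp τ)) ↔ IntegrableOn g (Set.Ioi 0) := by
  have h := integrableOn_image_iff_integrableOn_abs_deriv_smul (s := Set.univ) MeasurableSet.univ
    (fun x _ => (Real.hasDerivAt_exp x).hasDerivWithinAt) Real.exp_injective.injOn g
  rw [Set.image_univ, Real.range_exp, integrableOn_univ] at h
  simpa using h.symm

section ray
variable {F : ℂ → ℂ} {x C : ℝ}

/-- The integrand `t ^ (-3/2) (F x - F (x + t e))` of the singular integral of order `1/4` along the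
ray from the boundary point `x` in the direction `e`. -/
def rayQuotient (F : ℂ → ℂ) (x : ℝ) (e : ℂ) (t : ℝ) : ℂ :=
  (t ^ (-3 / 2 : ℝ) : ℝ) * (F x - F (x + t * e))

lemma norm_rayQuotient_le (hF : ∀ z : ℂ, 0 ≤ z.im → ‖F x - F z‖ ≤ C * min ‖z - x‖ 1)
    {e : ℂ} (he : ‖e‖ = 1) (he' : 0 ≤ e.im) {t : ℝ} (ht : 0 < t) :
    ‖rayQuotient F x e t‖ ≤ C * (t ^ (-3 / 2 : ℝ) * min t 1) := by
  have h1 : 0 < t ^ (-3 / 2 : ℝ) := by positivity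
  have h := hF (x + t * e) (by simp; positivity)
  have h2 : ‖(x : ℂ) + t * e - x‖ = t := by simp [he, abs_of_pos ht]
  rw [h2] at h
  rw [rayQuotient, norm_mul, norm_real, Real.norm_of_nonneg h1.le]
  calc _ ≤ t ^ (-3 / 2 : ℝ) * (C * min t 1) := by gcongr
    _ = _ := by ring

lemma integrableOn_rayQuotient (hc : ContinuousOn F {z | 0 ≤ z.im})
    (hF : ∀ z : ℂ, 0 ≤ z.im → ‖F x - F z‖ ≤ C * min ‖z - x‖ 1)
    {e : ℂ} (he : ‖e‖ = 1) (he' : 0 ≤ e.im) :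
    IntegrableOn (rayQuotient F x e) (Set.Ioi 0) := by
  have hM : IntegrableOn (fun t : ℝ => t ^ (-3 / 2 : ℝ) * min t 1) (Set.Ioi 0) := by
    refine (integrableOn_rpow_mul_min (a := -1 / 2) (by norm_num) (by norm_num)).congr_fun
      (fun t ht => ?_) measurableSet_Ioi
    have ht0 : 0 < t := ht
    simp only
    rw [show (-1 / 2 : ℝ) = -3 / 2 + 1 by norm_num, Real.rpow_add_one ht0.ne', mul_assoc,
      mul_min_of_nonneg _ _ ht0.le, mul_one, mul_inv_cancel₀ ht0.ne']
  refine (hM.const_mul C).mono' ?_ ?_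
  · refine ContinuousOn.aestronglyMeasurable ?_ measurableSet_Ioi
    refine ContinuousOn.mul ?_ (continuousOn_const.sub (hc.comp (by fun_prop) ?_))
    · refine continuous_ofReal.comp_continuousOn ?_
      exact ContinuousOn.rpow_const continuousOn_id (fun t ht => Or.inl (ne_of_gt ht))
    · intro t ht
      have : 0 < t := ht
      simp; positivity
  · filter_upwards [ae_restrict_mem measurableSet_Ioi] with t ht
    exact norm_rayQuotient_le hF he he' ht

/-- The integral of the difference quotient over a ray depends on the direction of the ray only
through a unimodular factor; in the logarithmic coordinate `ζ`, `z = x + e ^ ζ`, the rays become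
horizontal lines. -/
theorem integral_rayQuotient_rotate (hc : ContinuousOn F {z | 0 ≤ z.im})
    (hd : DifferentiableOn ℂ F {z | 0 < z.im})
    (hF : ∀ z : ℂ, 0 ≤ z.im → ‖F x - F z‖ ≤ C * min ‖z - x‖ 1)
    {a b : ℝ} (h0 : 0 ≤ a) (hab : a ≤ b) (hπ : b ≤ Real.pi) :
    exp (-(a * I) / 2) * ∫ t in Set.Ioi 0, rayQuotient F x (exp (a * I)) t =
      exp (-(b * I) / 2) * ∫ t in Set.Ioi 0, rayQuotient F x (exp (b * I)) t := by
  -- The integrand `(F x - F z) (z - x) ^ (-3/2) dz` in the coordinate `ζ`.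
  set g : ℂ → ℂ := fun ζ => (F x - F (x + exp ζ)) * exp (-ζ / 2) with hg
  have him : ∀ ζ : ℂ, 0 ≤ ζ.im → ζ.im ≤ Real.pi → 0 ≤ (x + exp ζ).im := fun ζ h1 h2 => by
    simp only [add_im, ofReal_im, exp_im, zero_add]
    exact mul_nonneg (Real.exp_pos _).le (Real.sin_nonneg_of_nonneg_of_le_pi h1 h2)
  have hline : ∀ y : ℝ, ∀ τ : ℝ, g (τ + y * I) = Real.exp τ •
      (exp (-(y * I) / 2) * rayQuotient F x (exp (y * I)) (Real.exp τ)) := by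
    intro y τ
    have h1 : (Real.exp τ : ℂ) * ((Real.exp τ) ^ (-3 / 2 : ℝ) : ℝ) = exp (-τ / 2) := by
      rw [← Real.exp_mul, ← ofReal_mul, ← Real.exp_add, ofReal_exp]
      congr 1; push_cast; ring
    have h2 : exp (-(τ + y * I) / 2) = exp (-τ / 2) * exp (-(y * I) / 2) := by
      rw [← exp_add]; ring_nf
    simp only [hg, rayQuotient, real_smul]
    rw [h2, ← h1, exp_add, ofReal_exp]
    ring
  have hnorm : ∀ y : ℝ, ‖exp (-(y * I) / 2)‖ = 1 := fun y => by
    rw [show -(y * I) / 2 = ((-y / 2 : ℝ) : ℂ) * I by push_cast; ring, norm_exp_ofReal_mul_I]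
  have himI : ∀ y : ℝ, 0 ≤ y → y ≤ Real.pi → 0 ≤ (exp (y * I)).im := fun y h1 h2 => by
    rw [exp_ofReal_mul_I_im]; exact Real.sin_nonneg_of_nonneg_of_le_pi h1 h2
  have hint : ∀ y : ℝ, 0 ≤ y → y ≤ Real.pi → Integrable fun τ : ℝ => g (τ + y * I) := by
    intro y h1 h2
    simp_rw [hline y]
    refine (integrable_exp_smul_iff
      (g := fun t => exp (-(y * I) / 2) * rayQuotient F x (exp (y * I)) t)).2 ?_
    exact (integrableOn_rayQuotient hc hF (norm_exp_ofReal_mul_I y) (himI y h1 h2)).const_mul _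
  have hval : ∀ y : ℝ, ∫ τ : ℝ, g (τ + y * I) =
      exp (-(y * I) / 2) * ∫ t in Set.Ioi 0, rayQuotient F x (exp (y * I)) t := by
    intro y
    simp_rw [hline y]
    rw [← integral_const_mul]
    exact (integral_Ioi_eq_integral_exp
      (fun t => exp (-(y * I) / 2) * rayQuotient F x (exp (y * I)) t)).symm
  rw [← hval, ← hval]
  refine integral_horizontal_line_eq (φ := fun τ => |C| * Real.exp (-|τ| / 2)) hab ?_ ?_ ?_ ?_
    (hint a h0 (hab.trans hπ)) (hint b (h0.trans hab) hπ)
  · refine ContinuousOn.mul (continuousOn_const.sub (hc.comp (by fun_prop) ?_)) (by fun_prop)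
    exact fun ζ hζ => him ζ (h0.trans hζ.1) (hζ.2.trans hπ)
  · refine DifferentiableOn.mul ((differentiableOn_const _).sub
      (hd.comp (by fun_prop) ?_)) (by fun_prop)
    intro ζ hζ
    simp only [Set.mem_ofPred_eq, add_im, ofReal_im, exp_im, zero_add]
    exact mul_pos (Real.exp_pos _)
      (Real.sin_pos_of_pos_of_lt_pi (h0.trans_lt hζ.1) (hζ.2.trans_le hπ))
  · refine Eventually.of_forall fun τ y hy => ?_
    rw [hline, norm_smul, norm_mul, hnorm, one_mul, Real.norm_of_nonneg (Real.exp_pos _).le]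
    have h := norm_rayQuotient_le hF (norm_exp_ofReal_mul_I y)
      (himI y (h0.trans hy.1) (hy.2.trans hπ)) (Real.exp_pos τ)
    have hexp : Real.exp τ * (Real.exp τ ^ (-3 / 2 : ℝ) * min (Real.exp τ) 1) ≤
        Real.exp (-|τ| / 2) := by
      rw [← mul_assoc, ← Real.exp_mul, ← Real.exp_add]
      rcases le_total 0 τ with h | h
      · rw [abs_of_nonneg h, show τ + τ * (-3 / 2) = -τ / 2 by ring]
        exact mul_le_of_le_one_right (Real.exp_pos _).le (min_le_right _ _)
      · calc _ ≤ Real.exp (τ + τ * (-3 / 2)) * Real.exp τ := by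
              gcongr; exact min_le_left _ _
          _ = _ := by rw [abs_of_nonpos h, ← Real.exp_add]; ring_nf
    calc _ ≤ Real.exp τ * (C * (Real.exp τ ^ (-3 / 2 : ℝ) * min (Real.exp τ) 1)) := by gcongr
      _ = C * (Real.exp τ * (Real.exp τ ^ (-3 / 2 : ℝ) * min (Real.exp τ) 1)) := by ring
      _ ≤ |C| * (Real.exp τ * (Real.exp τ ^ (-3 / 2 : ℝ) * min (Real.exp τ) 1)) := by
        gcongr; exact le_abs_self C
      _ ≤ _ := by gcongr
  · have h1 : Tendsto (fun τ : ℝ => -|τ| / 2) (cocompact ℝ) atBot :=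
      (tendsto_neg_atTop_atBot.comp (tendsto_norm_cocompact_atTop (E := ℝ))).atBot_div_const
        two_pos
    simpa using (Real.tendsto_exp_atBot.comp h1).const_mul |C|

lemma exp_neg_pi_div_four : exp (-(Real.pi / 4 * I)) = (√2 / 2 : ℝ) * (1 - I) := by
  rw [← neg_mul, exp_mul_I, cos_neg, sin_neg, show (Real.pi / 4 : ℂ) = ((Real.pi / 4 : ℝ) : ℂ) by
    push_cast; rfl, ← ofReal_cos, ← ofReal_sin, Real.cos_pi_div_four, Real.sin_pi_div_four]
  push_cast; ring

/-- The integrals over the two horizontal rays add up to `√2` times the integral over the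
vertical ray. -/
theorem integral_rayQuotient_one_add_neg_one (hc : ContinuousOn F {z | 0 ≤ z.im})
    (hd : DifferentiableOn ℂ F {z | 0 < z.im})
    (hF : ∀ z : ℂ, 0 ≤ z.im → ‖F x - F z‖ ≤ C * min ‖z - x‖ 1) :
    (∫ t in Set.Ioi 0, rayQuotient F x 1 t) + ∫ t in Set.Ioi 0, rayQuotient F x (-1) t =
      √2 * ∫ t in Set.Ioi 0, rayQuotient F x I t := by
  have hπ := Real.pi_pos
  have h1 := integral_rayQuotient_rotate hc hd hF le_rfl (b := Real.pi / 2) (by linarith)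
    (by linarith)
  have h2 := integral_rayQuotient_rotate hc hd hF (a := Real.pi / 2) (b := Real.pi) (by linarith)
    (by linarith) le_rfl
  push_cast at h1 h2
  rw [zero_mul, neg_zero, zero_div, exp_zero, one_mul, exp_pi_div_two_mul_I,
    show -(Real.pi / 2 * I) / 2 = -(Real.pi / 4 * I) by ring, exp_neg_pi_div_four] at h1
  rw [exp_pi_div_two_mul_I, exp_pi_mul_I, show -(Real.pi / 2 * I) / 2 = -(Real.pi / 4 * I) by ring,
    show -(Real.pi * I) / 2 = -(Real.pi / 2 * I) by ring, exp_neg_pi_div_four, exp_neg,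
    exp_pi_div_two_mul_I, inv_I] at h2
  rw [h1]
  push_cast at h2 ⊢
  linear_combination (-I) * h2 + ((∫ t in Set.Ioi 0, rayQuotient F x (-1) t) -
    √2 / 2 * ∫ t in Set.Ioi 0, rayQuotient F x I t) * I_sq

end ray
end Complex

/-! ### The fractional Laplacian as an integral over a vertical ray -/

lemma fracLapConst_one_div_four : fracLapConst (1 / 4) = √2 / (4 * √Real.pi) := by
  have h1 : Real.Gamma (-(1 / 4) + 1) = -(1 / 4) * Real.Gamma (-(1 / 4)) :=
    Real.Gamma_add_one (by norm_num)
  have h2 : 0 < Real.Gamma (3 / 4) := Real.Gamma_pos_of_pos (by norm_num)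
  have h3 : Real.Gamma (-(1 / 4)) = -4 * Real.Gamma (3 / 4) := by
    rw [show (-(1 / 4) + 1 : ℝ) = 3 / 4 by norm_num] at h1
    linarith
  have h4 : (4 : ℝ) ^ (1 / 4 : ℝ) = √2 := by
    rw [show (4 : ℝ) = 2 ^ (2 : ℝ) by norm_num, ← Real.rpow_mul (by norm_num), Real.sqrt_eq_rpow]
    norm_num
  rw [fracLapConst, h3, h4, show (1 / 2 + 1 / 4 : ℝ) = 3 / 4 by norm_num, abs_mul, abs_of_pos h2]
  norm_num
  field_simp

/-- The truncated domains exhaust the line up to the null set `{x}`. -/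
lemma aecover_lt_abs_sub (x : ℝ) :
    AECover volume (𝓝[>] (0 : ℝ)) fun ε => {y : ℝ | ε < |x - y|} where
  ae_eventually_mem := by
    have : ∀ᵐ y : ℝ, y ≠ x := by simp [ae_iff, measure_singleton]
    filter_upwards [this] with y hy
    have : 0 < |x - y| := abs_pos.2 (sub_ne_zero.2 hy.symm)
    exact mem_nhdsWithin_of_mem_nhds (Iio_mem_nhds this)
  measurableSet ε := measurableSet_lt measurable_const (by fun_prop)

/-- Where the singular integral converges absolutely no cancellation is needed. -/
lemma fracLap_of_integrable {s : ℝ} {u : ℝ → ℝ} {x : ℝ} (h : Integrable (fracLapIntegrand s u x)) :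
    FracLapExistsAt s u x ∧ fracLap s u x = fracLapConst s * ∫ y, fracLapIntegrand s u x y := by
  have ht : Tendsto (fracLapTrunc s u x) (𝓝[>] 0)
      (𝓝 (fracLapConst s * ∫ y, fracLapIntegrand s u x y)) :=
    ((aecover_lt_abs_sub x).integral_tendsto_of_countably_generated h).const_mul _
  exact ⟨⟨fun ε _ => h.integrableOn, _, ht⟩, ht.limUnder_eq⟩

namespace Complex

variable {F : ℂ → ℂ} {x C : ℝ}

/-- The kernel integral over the whole line converges absolutely and reduces to an integral over the
vertical ray. -/
lemma integrable_and_integral_of_ray (hc : ContinuousOn F {z | 0 ≤ z.im})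
    (hd : DifferentiableOn ℂ F {z | 0 < z.im})
    (hF : ∀ z : ℂ, 0 ≤ z.im → ‖F x - F z‖ ≤ C * min ‖z - x‖ 1) :
    Integrable (fun y : ℝ => ((|x - y| ^ (-3 / 2 : ℝ) : ℝ) : ℂ) * (F x - F y)) ∧
    ∫ y : ℝ, ((|x - y| ^ (-3 / 2 : ℝ) : ℝ) : ℂ) * (F x - F y) =
      √2 * ∫ t in Set.Ioi 0, rayQuotient F x I t := by
  set k : ℝ → ℂ := fun y => ((|x - y| ^ (-3 / 2 : ℝ) : ℝ) : ℂ) * (F x - F y) with hk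
  have hr : Set.EqOn (fun h => k (x + h)) (rayQuotient F x 1) (Set.Ioi 0) := by
    intro t ht
    have : 0 < t := ht
    simp [hk, rayQuotient, abs_of_pos this]
  have hl : Set.EqOn (fun h => k (x + -h)) (rayQuotient F x (-1)) (Set.Ioi 0) := by
    intro t ht
    have : 0 < t := ht
    simp [hk, rayQuotient, abs_of_pos this]
  have ir : IntegrableOn (fun h => k (x + h)) (Set.Ioi 0) :=
    (integrableOn_rayQuotient hc hF (by simp) (by simp)).congr_fun hr.symm measurableSet_Ioi
  have il : IntegrableOn (fun h => k (x + -h)) (Set.Ioi 0) :=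
    (integrableOn_rayQuotient hc hF (by simp) (by simp)).congr_fun hl.symm measurableSet_Ioi
  have il' : IntegrableOn (fun h => k (x + h)) (Set.Iic 0) := by
    rw [integrableOn_Iic_iff_integrableOn_Iio]
    have h := IntegrableOn.comp_neg_Iio (c := (0 : ℝ)) (f := fun h => k (x + -h))
      (by rwa [neg_zero])
    simpa only [neg_neg] using h
  have hsum := integral_rayQuotient_one_add_neg_one hc hd hF
  have er : ∫ h in Set.Ioi 0, k (x + h) = ∫ t in Set.Ioi 0, rayQuotient F x 1 t :=
    setIntegral_congr_fun measurableSet_Ioi hr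
  have el : ∫ h in Set.Iic 0, k (x + h) = ∫ t in Set.Ioi 0, rayQuotient F x (-1) t := by
    have := integral_comp_neg_Ioi 0 (fun h => k (x + h))
    rw [neg_zero] at this
    rw [← this]
    exact setIntegral_congr_fun measurableSet_Ioi hl
  rw [← er, ← el, add_comm] at hsum
  refine ⟨?_, ?_⟩
  · have : Integrable fun h => k (x + h) := by
      rw [← integrableOn_univ, ← Set.Iic_union_Ioi (a := (0 : ℝ))]
      exact il'.union ir
    simpa using this.comp_add_left (-x)
  · rw [← hsum, intervalIntegral.integral_Iic_add_Ioi il' ir, integral_add_left_eq_self]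

/-- The fractional Laplacian of order `1/4` of the image of the boundary values of a bounded
holomorphic function under a real functional `ℓ`, such as the real or the imaginary part, as an
integral over a vertical ray. -/
theorem fracLap_of_ray (ℓ : ℂ →L[ℝ] ℝ) {u : ℝ → ℝ} (hu : ∀ y : ℝ, u y = ℓ (F y))
    (hc : ContinuousOn F {z | 0 ≤ z.im})
    (hd : DifferentiableOn ℂ F {z | 0 < z.im})
    (hF : ∀ z : ℂ, 0 ≤ z.im → ‖F x - F z‖ ≤ C * min ‖z - x‖ 1) :
    FracLapExistsAt (1 / 4) u x ∧ fracLap (1 / 4) u x =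
      ℓ ((1 / (2 * √Real.pi) : ℝ) * ∫ t in Set.Ioi 0, rayQuotient F x I t) := by
  obtain ⟨hi, hv⟩ := integrable_and_integral_of_ray hc hd hF
  have he : fracLapIntegrand (1 / 4) u x =
      fun y => ℓ (((|x - y| ^ (-3 / 2 : ℝ) : ℝ) : ℂ) * (F x - F y)) := by
    ext y
    rw [fracLapIntegrand, hu, hu, ← map_sub, ← real_smul, map_smul, smul_eq_mul,
      show (1 + 2 * (1 / 4) : ℝ) = 3 / 2 by norm_num, neg_div, Real.rpow_neg (abs_nonneg _),
      div_eq_mul_inv, mul_comm]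
  have hint : Integrable (fracLapIntegrand (1 / 4) u x) := by
    rw [he]; exact ℓ.integrable_comp hi
  obtain ⟨h1, h2⟩ := fracLap_of_integrable hint
  refine ⟨h1, ?_⟩
  have h3 : (√2 : ℝ) * √2 = 2 := Real.mul_self_sqrt (by norm_num)
  rw [h2, he, ℓ.integral_comp_comm hi, hv, fracLapConst_one_div_four, ← smul_eq_mul, ← map_smul,
    real_smul, ← mul_assoc, ← ofReal_mul]
  congr 3
  field_simp
  linarith

end Complex

/-! ### Majorants -/

/-- The exponent `p < 1` makes the singularities at `±1` integrable and `2 p > 1` the tails. -/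
lemma integrable_abs_sq_sub_one_rpow {p : ℝ} (h1 : 1 / 2 < p) (h2 : p < 1) :
    Integrable fun x : ℝ => |x ^ 2 - 1| ^ (-p) := by
  have habs : ∀ a b : ℝ, IntervalIntegrable (fun x : ℝ => |x| ^ (-p)) volume a b := by
    refine fun a b => intervalIntegrable_of_even (by simp) (fun c hc => ?_)
    refine (intervalIntegral.intervalIntegrable_rpow' (r := -p) (by linarith)).congr fun t ht => ?_
    rw [Set.uIoc_of_le hc.le] at ht
    simp [abs_of_pos ht.1]
  have hmeas : Measurable fun x : ℝ => |x ^ 2 - 1| ^ (-p) := by fun_prop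
  have hmid : IntegrableOn (fun x : ℝ => |x ^ 2 - 1| ^ (-p)) (Set.Ioc (-2) 2) := by
    have i1 := (habs (-3) 1).comp_sub_right 1
    have i2 := (habs (-1) 3).comp_sub_right (-1)
    norm_num at i1 i2
    rw [intervalIntegrable_iff_integrableOn_Ioc_of_le (by norm_num)] at i1 i2
    refine (i1.add i2).mono' hmeas.aestronglyMeasurable ?_
    filter_upwards [ae_restrict_mem measurableSet_Ioc] with x hx
    have e : x ^ 2 - 1 = (x - 1) * (x + 1) := by ring
    rw [Real.norm_of_nonneg (by positivity), e, abs_mul, Real.mul_rpow (abs_nonneg _) (abs_nonneg _)]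
    have n1 : 0 ≤ |x - 1| ^ (-p) := by positivity
    have n2 : 0 ≤ |x + 1| ^ (-p) := by positivity
    -- The point is at distance at least `1` from one of `±1`, so one factor is at most `1`.
    simp only [Pi.add_apply]
    rcases le_total 0 x with h | h
    · have : |x + 1| ^ (-p) ≤ 1 := Real.rpow_le_one_of_one_le_of_nonpos
        (by rw [abs_of_nonneg (by linarith)]; linarith) (by linarith)
      nlinarith
    · have : |x - 1| ^ (-p) ≤ 1 := Real.rpow_le_one_of_one_le_of_nonpos
        (by rw [abs_of_nonpos (by linarith)]; linarith) (by linarith)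
      nlinarith
  have hright : IntegrableOn (fun x : ℝ => |x ^ 2 - 1| ^ (-p)) (Set.Ioi 2) := by
    refine ((integrableOn_Ioi_rpow_of_lt (a := -(2 * p)) (by linarith) two_pos).const_mul
      (2 ^ p)).mono' hmeas.aestronglyMeasurable ?_
    filter_upwards [ae_restrict_mem measurableSet_Ioi] with x hx
    have hx' : 2 < x := hx
    rw [Real.norm_of_nonneg (by positivity)]
    calc |x ^ 2 - 1| ^ (-p) ≤ (x ^ 2 / 2) ^ (-p) := by
          refine Real.rpow_le_rpow_of_nonpos (by positivity) ?_ (by linarith)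
          exact le_trans (by nlinarith) (le_abs_self _)
      _ = 2 ^ p * x ^ (-(2 * p)) := by
          rw [Real.div_rpow (by positivity) (by norm_num), Real.rpow_neg two_pos.le,
            ← Real.rpow_natCast x 2, ← Real.rpow_mul (by linarith)]
          push_cast
          field_simp
  have hleft : IntegrableOn (fun x : ℝ => |x ^ 2 - 1| ^ (-p)) (Set.Iic (-2)) := by
    rw [integrableOn_Iic_iff_integrableOn_Iio]
    have h := IntegrableOn.comp_neg_Iio (c := (-2 : ℝ)) (f := fun x : ℝ => |x ^ 2 - 1| ^ (-p))
      (by rwa [neg_neg])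
    simpa using h
  rw [← integrableOn_univ, ← Set.Iic_union_Ioi (a := (-2 : ℝ)),
    ← Set.Ioc_union_Ioi_eq_Ioi (show (-2 : ℝ) ≤ 2 by norm_num)]
  exact hleft.union (hmid.union hright)

lemma tendsto_abs_sq_sub_one_rpow {p : ℝ} (hp : 0 < p) :
    Tendsto (fun x : ℝ => |x ^ 2 - 1| ^ (-p)) (cocompact ℝ) (𝓝 0) := by
  refine (tendsto_rpow_neg_atTop hp).comp ?_
  have h : Tendsto (fun x : ℝ => ‖x‖ ^ 2 - 1) (cocompact ℝ) atTop :=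
    tendsto_atTop_add_const_right _ _
      ((tendsto_pow_atTop two_ne_zero).comp (tendsto_norm_cocompact_atTop (E := ℝ)))
  refine tendsto_atTop_mono (fun x => ?_) h
  simpa only [Real.norm_eq_abs, sq_abs] using! le_abs_self (x ^ 2 - 1)

lemma ae_sq_ne_one : ∀ᵐ x : ℝ, x ^ 2 ≠ 1 := by
  have h : ∀ a : ℝ, ∀ᵐ x : ℝ, x ≠ a := fun a => by simp [ae_iff, measure_singleton]
  filter_upwards [h 1, h (-1)] with x h1 h2
  exact fun h => (sq_eq_sq_iff_eq_or_eq_neg.1 (h.trans (one_pow 2).symm)).elim h1 h2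

namespace Complex

/-- The factor `t ^ (-1/4) * min 1 (1/t)` in the majorant of the derivative of the powers of the
inverse Joukowski map along vertical lines. -/
def verticalDecay (t : ℝ) : ℝ := t ^ (-1 / 4 : ℝ) * min 1 t⁻¹

lemma verticalDecay_nonneg {t : ℝ} (ht : 0 < t) : 0 ≤ verticalDecay t := by
  unfold verticalDecay; positivity

lemma integrableOn_verticalDecay : IntegrableOn verticalDecay (Set.Ioi 0) :=
  integrableOn_rpow_mul_min (by norm_num) (by norm_num)

lemma integrableOn_rpow_mul_verticalDecay :
    IntegrableOn (fun t => t ^ (-1 / 2 : ℝ) * verticalDecay t) (Set.Ioi 0) := by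
  refine (integrableOn_rpow_mul_min (a := -3 / 4) (by norm_num) (by norm_num)).congr_fun
    (fun t ht => ?_) measurableSet_Ioi
  have ht0 : 0 < t := ht
  simp only [verticalDecay]
  rw [← mul_assoc, ← Real.rpow_add ht0]
  norm_num

lemma antitoneOn_verticalDecay : AntitoneOn verticalDecay (Set.Ioi 0) := by
  intro s hs t ht hst
  have hs' : 0 < s := hs
  have ht' : 0 < t := ht
  unfold verticalDecay
  refine mul_le_mul (Real.rpow_le_rpow_of_nonpos hs' hst (by norm_num))
    (min_le_min_left _ (inv_anti₀ hs' hst)) (by positivity) (by positivity)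

lemma tendsto_verticalDecay : Tendsto verticalDecay atTop (𝓝 0) := by
  refine squeeze_zero' (g := fun t => t⁻¹) ?_ ?_ tendsto_inv_atTop_zero
  · filter_upwards [eventually_gt_atTop 0] with t ht using verticalDecay_nonneg ht
  · filter_upwards [eventually_ge_atTop 1] with t ht
    have h : t ^ (-1 / 4 : ℝ) ≤ 1 := Real.rpow_le_one_of_one_le_of_nonpos ht (by norm_num)
    calc verticalDecay t ≤ 1 * t⁻¹ := by
          unfold verticalDecay; gcongr; exact min_le_right _ _
      _ = t⁻¹ := one_mul _

section bounds
variable {n : ℕ} {x t : ℝ}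

lemma add_mul_I_ne_one (hx : x ^ 2 ≠ 1) : (x + t * I : ℂ) ≠ 1 := fun h => by
  have := congrArg re h
  simp at this
  simp [this] at hx

lemma add_mul_I_ne_neg_one (hx : x ^ 2 ≠ 1) : (x + t * I : ℂ) ≠ -1 := fun h => by
  have := congrArg re h
  simp at this
  simp [this] at hx

lemma ofReal_ne_one_of_sq_ne_one (hx : x ^ 2 ≠ 1) : (x : ℂ) ≠ 1 := by
  simpa using add_mul_I_ne_one (t := 0) hx

lemma ofReal_ne_neg_one_of_sq_ne_one (hx : x ^ 2 ≠ 1) : (x : ℂ) ≠ -1 := by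
  simpa using add_mul_I_ne_neg_one (t := 0) hx

lemma abs_sq_sub_one_le : |x ^ 2 - 1| ≤ ‖(x + t * I : ℂ) - 1‖ * ‖(x + t * I : ℂ) + 1‖ := by
  have h1 := abs_re_le_norm ((x + t * I : ℂ) - 1)
  have h2 := abs_re_le_norm ((x + t * I : ℂ) + 1)
  simp at h1 h2
  rw [show x ^ 2 - 1 = (x - 1) * (x + 1) by ring, abs_mul]
  gcongr

lemma sq_le_norm_mul_norm : t ^ 2 ≤ ‖(x + t * I : ℂ) - 1‖ * ‖(x + t * I : ℂ) + 1‖ := by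
  have h1 := abs_im_le_norm ((x + t * I : ℂ) - 1)
  have h2 := abs_im_le_norm ((x + t * I : ℂ) + 1)
  simp at h1 h2
  rw [← sq_abs, sq]
  gcongr

lemma norm_joukowskiInvPowDeriv (n : ℕ) (z : ℂ) : ‖joukowskiInvPowDeriv n z‖ =
    n * ‖joukowskiInv z‖ ^ n * (‖z - 1‖ * ‖z + 1‖) ^ (-1 / 2 : ℝ) := by
  rw [joukowskiInvPowDeriv, norm_div, norm_mul, norm_mul, norm_pow, norm_joukowskiRoot,
    Real.sqrt_eq_rpow, neg_div, Real.rpow_neg (by positivity)]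
  simp [div_eq_mul_inv]

/-- A bound that is uniform up to the real line. -/
lemma norm_joukowskiInvPowDeriv_le_rpow (hx : x ^ 2 ≠ 1) (ht : 0 ≤ t) :
    ‖joukowskiInvPowDeriv n (x + t * I)‖ ≤ n * |x ^ 2 - 1| ^ (-(1 / 2) : ℝ) := by
  have h0 : 0 < |x ^ 2 - 1| := abs_pos.2 (sub_ne_zero.2 hx)
  rw [norm_joukowskiInvPowDeriv, neg_div]
  have hw : ‖joukowskiInv (x + t * I)‖ ≤ 1 := norm_joukowskiInv_le_one (by simpa using ht)
  calc _ ≤ (n : ℝ) * 1 * |x ^ 2 - 1| ^ (-(1 / 2) : ℝ) := by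
        gcongr ?_ * ?_ * ?_
        · exact pow_le_one₀ (norm_nonneg _) hw
        · exact Real.rpow_le_rpow_of_nonpos h0 abs_sq_sub_one_le (by norm_num)
    _ = _ := by ring

/-- A bound that separates the variables, square integrable in `x` and integrable in `t` also with
the weight `t ^ (-1/2)`. -/
lemma norm_joukowskiInvPowDeriv_le (hn : 1 ≤ n) (hx : x ^ 2 ≠ 1) (ht : 0 < t) :
    ‖joukowskiInvPowDeriv n (x + t * I)‖ ≤ n * |x ^ 2 - 1| ^ (-(3 / 8) : ℝ) * verticalDecay t := by
  have h0 : 0 < |x ^ 2 - 1| := abs_pos.2 (sub_ne_zero.2 hx)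
  have him : 0 ≤ (x + t * I : ℂ).im := by simpa using ht.le
  have hw : ‖joukowskiInv (x + t * I)‖ ≤ 1 := norm_joukowskiInv_le_one him
  have hw' : ‖joukowskiInv (x + t * I)‖ ≤ t⁻¹ := by
    have h := norm_joukowskiInv_mul_norm_le_one him
    have h1 := abs_im_le_norm (x + t * I : ℂ)
    simp [abs_of_pos ht] at h1
    rw [← one_div, le_div_iff₀ ht]
    exact (mul_le_mul_of_nonneg_left h1 (norm_nonneg _)).trans h
  have hP : 0 < ‖(x + t * I : ℂ) - 1‖ * ‖(x + t * I : ℂ) + 1‖ := h0.trans_le abs_sq_sub_one_le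
  -- `‖z - 1‖ ‖z + 1‖` dominates both `|x² - 1|` and `t²`; its power `-1/2` is split as `-3/8 - 1/8`.
  have hsplit : (‖(x + t * I : ℂ) - 1‖ * ‖(x + t * I : ℂ) + 1‖) ^ (-1 / 2 : ℝ) ≤
      |x ^ 2 - 1| ^ (-(3 / 8) : ℝ) * t ^ (-1 / 4 : ℝ) := by
    rw [show (-1 / 2 : ℝ) = -(3 / 8) + -(1 / 8) by norm_num, Real.rpow_add hP]
    have e : t ^ (-1 / 4 : ℝ) = (t ^ 2) ^ (-(1 / 8) : ℝ) := by
      rw [← Real.rpow_natCast, ← Real.rpow_mul ht.le]; norm_num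
    rw [e]
    exact mul_le_mul (Real.rpow_le_rpow_of_nonpos h0 abs_sq_sub_one_le (by norm_num))
      (Real.rpow_le_rpow_of_nonpos (by positivity) sq_le_norm_mul_norm (by norm_num))
      (by positivity) (by positivity)
  rw [norm_joukowskiInvPowDeriv]
  calc _ ≤ (n : ℝ) * min 1 t⁻¹ * (|x ^ 2 - 1| ^ (-(3 / 8) : ℝ) * t ^ (-1 / 4 : ℝ)) := by
        gcongr
        exact (pow_le_of_le_one (norm_nonneg _) hw (by omega)).trans (le_min hw hw')
    _ = _ := by rw [verticalDecay]; ring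

end bounds
end Complex

/-! ### The half-derivative of the powers of the inverse Joukowski map -/

/-- The half-derivative `(-i d/dz)^{1/2}` of the `n`-th power of the inverse Joukowski map at a
boundary point, as a Weyl fractional integral of the derivative along a vertical ray. -/
def joukowskiHalfDeriv (n : ℕ) (x : ℝ) : ℂ :=
  -Complex.I / (√Real.pi : ℝ) * ∫ t in Set.Ioi (0 : ℝ),
    ((t ^ (-1 / 2 : ℝ) : ℝ) : ℂ) * joukowskiInvPowDeriv n (x + t * Complex.I)

namespace Complex
variable {n : ℕ} {x t : ℝ}

/-- Differentiability at `x` gives a Lipschitz bound near `x`; farther away boundedness suffices. -/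
lemma exists_norm_joukowskiInv_pow_sub_le (n : ℕ) (hx : x ^ 2 ≠ 1) :
    ∃ C, ∀ z : ℂ, 0 ≤ z.im →
      ‖joukowskiInv x ^ n - joukowskiInv z ^ n‖ ≤ C * min ‖z - x‖ 1 := by
  have hd := (hasDerivAt_joukowskiInv_pow n (z := x) (by simp) (ofReal_ne_one_of_sq_ne_one hx)
    (ofReal_ne_neg_one_of_sq_ne_one hx)).isBigO_sub
  obtain ⟨K, hK⟩ := hd.bound
  obtain ⟨δ, hδ, hball⟩ := Metric.eventually_nhds_iff.1 hK
  have hbd : ∀ z : ℂ, 0 ≤ z.im → ‖joukowskiInv x ^ n - joukowskiInv z ^ n‖ ≤ 2 := by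
    intro z hz
    refine (norm_sub_le _ _).trans ?_
    rw [norm_pow, norm_pow]
    have h1 := pow_le_one₀ (n := n) (norm_nonneg _)
      (norm_joukowskiInv_le_one (z := x) (by simp))
    have h2 := pow_le_one₀ (n := n) (norm_nonneg _) (norm_joukowskiInv_le_one hz)
    linarith
  refine ⟨max (max K 2) (2 / δ), fun z hz => ?_⟩
  have hC : 2 ≤ max (max K 2) (2 / δ) := (le_max_right _ _).trans (le_max_left _ _)
  rcases le_total ‖z - x‖ 1 with h | h
  · rw [min_eq_left h]
    rcases lt_or_ge ‖z - x‖ δ with h' | h'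
    · rw [norm_sub_rev]
      refine (hball (by rwa [dist_eq_norm])).trans ?_
      gcongr
      exact (le_max_left _ _).trans (le_max_left _ _)
    · calc _ ≤ 2 := hbd z hz
        _ = 2 / δ * δ := by field_simp
        _ ≤ _ := by
          gcongr
          exact le_max_right _ _
  · rw [min_eq_right h, mul_one]
    exact (hbd z hz).trans hC

lemma measurable_joukowskiInvPowDeriv_vertical (n : ℕ) :
    Measurable fun p : ℝ × ℝ => joukowskiInvPowDeriv n (p.1 + p.2 * I) :=
  (measurable_joukowskiInvPowDeriv n).comp (by fun_prop)

lemma measurable_rpow_mul_joukowskiInvPowDeriv (n : ℕ) :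
    Measurable fun p : ℝ × ℝ =>
      ((p.2 ^ (-1 / 2 : ℝ) : ℝ) : ℂ) * joukowskiInvPowDeriv n (p.1 + p.2 * I) :=
  Measurable.mul (by fun_prop) (measurable_joukowskiInvPowDeriv_vertical n)

lemma norm_rpow_mul_joukowskiInvPowDeriv_le (hn : 1 ≤ n) (hx : x ^ 2 ≠ 1) (ht : 0 < t) :
    ‖((t ^ (-1 / 2 : ℝ) : ℝ) : ℂ) * joukowskiInvPowDeriv n (x + t * I)‖ ≤
      n * |x ^ 2 - 1| ^ (-(3 / 8) : ℝ) * (t ^ (-1 / 2 : ℝ) * verticalDecay t) := by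
  have h0 : 0 ≤ t ^ (-1 / 2 : ℝ) := by positivity
  rw [norm_mul, norm_real, Real.norm_of_nonneg h0]
  calc _ ≤ t ^ (-1 / 2 : ℝ) * (n * |x ^ 2 - 1| ^ (-(3 / 8) : ℝ) * verticalDecay t) := by
        gcongr; exact norm_joukowskiInvPowDeriv_le hn hx ht
    _ = _ := by ring

lemma integrableOn_rpow_mul_joukowskiInvPowDeriv (hn : 1 ≤ n) (hx : x ^ 2 ≠ 1) :
    IntegrableOn (fun t : ℝ => ((t ^ (-1 / 2 : ℝ) : ℝ) : ℂ) *
      joukowskiInvPowDeriv n (x + t * I)) (Set.Ioi 0) := by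
  refine (integrableOn_rpow_mul_verticalDecay.const_mul
    (n * |x ^ 2 - 1| ^ (-(3 / 8) : ℝ))).mono' ?_ ?_
  · exact ((measurable_rpow_mul_joukowskiInvPowDeriv n).comp
      measurable_prodMk_left).aestronglyMeasurable
  · filter_upwards [ae_restrict_mem measurableSet_Ioi] with t ht
    exact norm_rpow_mul_joukowskiInvPowDeriv_le hn hx ht

lemma hasDerivAt_joukowskiInv_pow_vertical (hx : x ^ 2 ≠ 1) (ht : 0 ≤ t) :
    HasDerivAt (fun t : ℝ => joukowskiInv (x + t * I) ^ n)
      (I * joukowskiInvPowDeriv n (x + t * I)) t := by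
  have h1 : HasDerivAt (fun t : ℝ => (x + t * I : ℂ)) I t := by
    simpa using ((ofRealCLM.hasDerivAt (x := t)).mul_const I).const_add (x : ℂ)
  have h2 := hasDerivAt_joukowskiInv_pow n (z := x + t * I) (by simpa using ht)
    (add_mul_I_ne_one hx) (add_mul_I_ne_neg_one hx)
  have := h2.scomp t h1
  simpa [Function.comp_def] using this

/-- Integration by parts along the vertical ray. -/
lemma integral_rayQuotient_I (hn : 1 ≤ n) (hx : x ^ 2 ≠ 1) :
    ∫ t in Set.Ioi 0, rayQuotient (fun z => joukowskiInv z ^ n) x I t =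
      -2 * I * ∫ t in Set.Ioi (0 : ℝ),
        ((t ^ (-1 / 2 : ℝ) : ℝ) : ℂ) * joukowskiInvPowDeriv n (x + t * I) := by
  obtain ⟨C, hC⟩ := exists_norm_joukowskiInv_pow_sub_le n hx
  set u : ℝ → ℂ := fun t => joukowskiInv x ^ n - joukowskiInv (x + t * I) ^ n with hu
  set v : ℝ → ℂ := fun t => ((-2 * t ^ (-1 / 2 : ℝ) : ℝ) : ℂ) with hv
  have hu' : ∀ t ∈ Set.Ioi (0 : ℝ),
      HasDerivAt u (-(I * joukowskiInvPowDeriv n (x + t * I))) t := fun t ht =>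
    (hasDerivAt_joukowskiInv_pow_vertical hx (le_of_lt ht)).const_sub _
  have hv' : ∀ t ∈ Set.Ioi (0 : ℝ), HasDerivAt v ((t ^ (-3 / 2 : ℝ) : ℝ) : ℂ) t := fun t ht => by
    have h := ((Real.hasDerivAt_rpow_const (p := -1 / 2)
      (Or.inl (ne_of_gt ht) : t ≠ 0 ∨ _)).const_mul (-2)).ofReal_comp
    refine h.congr_deriv ?_
    rw [show (-1 / 2 - 1 : ℝ) = -3 / 2 by norm_num]
    push_cast; ring
  have hprod : Set.EqOn (fun t => u t * ((t ^ (-3 / 2 : ℝ) : ℝ) : ℂ))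
      (rayQuotient (fun z => joukowskiInv z ^ n) x I) (Set.Ioi 0) := fun t ht => by
    simp only [hu, rayQuotient]; ring
  have hprod' : ∀ t : ℝ, -(I * joukowskiInvPowDeriv n (x + t * I)) * v t = 2 * I *
      (((t ^ (-1 / 2 : ℝ) : ℝ) : ℂ) * joukowskiInvPowDeriv n (x + t * I)) := fun t => by
    simp only [hv]; push_cast; ring
  have hnorm : ∀ t : ℝ, 0 < t → ‖(u * v) t‖ ≤ C * (2 * (t ^ (-1 / 2 : ℝ) * min t 1)) := by
    intro t ht
    have h1 := hC (x + t * I) (by simpa using ht.le)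
    have h2 : ‖(x : ℂ) + t * I - x‖ = t := by simp [abs_of_pos ht]
    rw [h2] at h1
    have h3 : ‖v t‖ = 2 * t ^ (-1 / 2 : ℝ) := by
      have : 0 ≤ t ^ (-1 / 2 : ℝ) := by positivity
      simp only [hv]
      rw [norm_real, norm_mul, Real.norm_of_nonneg this]
      norm_num
    rw [Pi.mul_apply, norm_mul, h3]
    calc _ ≤ (C * min t 1) * (2 * t ^ (-1 / 2 : ℝ)) := by gcongr
      _ = _ := by ring
  have hC0 : 0 ≤ C := by
    have := hC (x + 1 * I) (by simp)
    have h2 : ‖(x : ℂ) + 1 * I - x‖ = 1 := by simp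
    rw [h2, min_self, mul_one] at this
    exact (norm_nonneg _).trans this
  have hzero : Tendsto (u * v) (𝓝[>] 0) (𝓝 0) := by
    have h0 : Tendsto (fun t : ℝ => C * (2 * t ^ (1 / 2 : ℝ))) (𝓝[>] 0) (𝓝 0) := by
      have : Continuous fun t : ℝ => C * (2 * t ^ (1 / 2 : ℝ)) :=
        continuous_const.mul (continuous_const.mul (Real.continuous_rpow_const (by norm_num)))
      have h := this.tendsto 0
      rw [Real.zero_rpow (by norm_num), mul_zero, mul_zero] at h
      exact h.mono_left nhdsWithin_le_nhds
    refine squeeze_zero_norm' ?_ h0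
    filter_upwards [self_mem_nhdsWithin] with t ht
    have ht0 : 0 < t := ht
    refine (hnorm t ht).trans ?_
    gcongr
    calc t ^ (-1 / 2 : ℝ) * min t 1 ≤ t ^ (-1 / 2 : ℝ) * t := by
          gcongr; exact min_le_left _ _
      _ = _ := by rw [← Real.rpow_add_one ht0.ne']; norm_num
  have hinf : Tendsto (u * v) atTop (𝓝 0) := by
    have h0 : Tendsto (fun t : ℝ => C * (2 * t ^ (-(1 / 2) : ℝ))) atTop (𝓝 0) := by
      simpa using ((tendsto_rpow_neg_atTop (y := 1 / 2) (by norm_num)).const_mul 2).const_mul C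
    refine squeeze_zero_norm' ?_ h0
    filter_upwards [eventually_gt_atTop 0] with t ht
    refine (hnorm t ht).trans ?_
    rw [← neg_div]
    gcongr
    exact mul_le_of_le_one_right (by positivity) (min_le_right _ _)
  have hF : IntegrableOn (rayQuotient (fun z => joukowskiInv z ^ n) x I) (Set.Ioi 0) :=
    integrableOn_rayQuotient (continuousOn_joukowskiInv.pow n) hC (by simp) (by simp)
  have key := integral_Ioi_mul_deriv_eq_deriv_mul hu' hv'
    (hF.congr_fun hprod.symm measurableSet_Ioi)
    (IntegrableOn.congr_fun ((integrableOn_rpow_mul_joukowskiInvPowDeriv hn hx).const_mul (2 * I))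
      (fun t _ => (hprod' t).symm) measurableSet_Ioi) hzero hinf
  rw [setIntegral_congr_fun measurableSet_Ioi hprod] at key
  rw [key, setIntegral_congr_fun measurableSet_Ioi fun t _ => hprod' t, integral_const_mul]
  ring

/-- Both fractional Laplacians are read off from the half-derivative of one holomorphic
function. -/
theorem fracLap_of_joukowskiInv_pow (ℓ : ℂ →L[ℝ] ℝ) {u : ℝ → ℝ} (hn : 1 ≤ n)
    (hu : ∀ y : ℝ, u y = ℓ (joukowskiInv y ^ n)) (hx : x ^ 2 ≠ 1) :
    FracLapExistsAt (1 / 4) u x ∧ fracLap (1 / 4) u x = ℓ (joukowskiHalfDeriv n x) := by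
  obtain ⟨C, hC⟩ := exists_norm_joukowskiInv_pow_sub_le n hx
  have hd : DifferentiableOn ℂ (fun z => joukowskiInv z ^ n) {z | 0 < z.im} := by
    intro z hz
    have hz' : 0 < z.im := hz
    refine (hasDerivAt_joukowskiInv_pow n hz'.le ?_ ?_).differentiableAt.differentiableWithinAt
    · rintro rfl; simp at hz'
    · rintro rfl; simp at hz'
  obtain ⟨h1, h2⟩ := fracLap_of_ray (F := fun z => joukowskiInv z ^ n) ℓ hu
    (continuousOn_joukowskiInv.pow n) hd hC
  refine ⟨h1, h2.trans ?_⟩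
  have hπ : (√Real.pi : ℂ) ≠ 0 := by
    exact_mod_cast (Real.sqrt_pos.2 Real.pi_pos).ne'
  rw [integral_rayQuotient_I hn hx, joukowskiHalfDeriv, ← mul_assoc]
  congr 2
  push_cast
  field_simp

end Complex

/-! ### Pairings of derivatives on horizontal lines -/

/-- Fubini for a product of two parameter integrals dominated by functions with separated
variables. -/
lemma integral_mul_integral_swap {f g : ℝ × ℝ → ℂ} (hf : Measurable f) (hg : Measurable g)
    {μ : Measure ℝ} [SFinite μ] {ρ k m : ℝ → ℝ} (hρ : Integrable fun x => ρ x * ρ x)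
    (hk : Integrable k μ) (hm : Integrable m μ)
    (hfk : ∀ᵐ x, ∀ᵐ s ∂μ, ‖f (x, s)‖ ≤ ρ x * k s)
    (hgm : ∀ᵐ x, ∀ᵐ s ∂μ, ‖g (x, s)‖ ≤ ρ x * m s) :
    Integrable (fun p : ℝ × ℝ => ∫ x, f (x, p.1) * g (x, p.2)) (μ.prod μ) ∧
    ∫ x, (∫ s, f (x, s) ∂μ) * (∫ t, g (x, t) ∂μ) =
      ∫ p, (∫ x, f (x, p.1) * g (x, p.2)) ∂(μ.prod μ) := by
  have hi : Integrable (fun q : ℝ × (ℝ × ℝ) => f (q.1, q.2.1) * g (q.1, q.2.2))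
      (volume.prod (μ.prod μ)) := by
    have hmf : Measurable fun q : ℝ × (ℝ × ℝ) => f (q.1, q.2.1) := hf.comp (by fun_prop)
    have hmg : Measurable fun q : ℝ × (ℝ × ℝ) => g (q.1, q.2.2) := hg.comp (by fun_prop)
    have hmaj : Integrable (fun q : ℝ × (ℝ × ℝ) => (ρ q.1 * ρ q.1) * (k q.2.1 * m q.2.2))
        (volume.prod (μ.prod μ)) := hρ.mul_prod (hk.mul_prod hm)
    have hmfg : Measurable fun q : ℝ × (ℝ × ℝ) => f (q.1, q.2.1) * g (q.1, q.2.2) := hmf.mul hmg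
    rw [integrable_prod_iff hmfg.aestronglyMeasurable]
    have hslice : ∀ᵐ x, ∀ᵐ p ∂(μ.prod μ), ‖f (x, p.1) * g (x, p.2)‖ ≤
        (ρ x * ρ x) * (k p.1 * m p.2) := by
      filter_upwards [hfk, hgm] with x h1 h2
      filter_upwards [Measure.quasiMeasurePreserving_fst.ae h1,
        Measure.quasiMeasurePreserving_snd.ae h2] with p h3 h4
      rw [norm_mul]
      calc _ ≤ (ρ x * k p.1) * (ρ x * m p.2) :=
            mul_le_mul h3 h4 (norm_nonneg _) ((norm_nonneg _).trans h3)
        _ = _ := by ring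
    refine ⟨?_, ?_⟩
    · filter_upwards [hslice] with x hx
      refine ((hk.mul_prod hm).const_mul (ρ x * ρ x)).mono' ?_ hx
      exact (hmfg.comp measurable_prodMk_left).aestronglyMeasurable
    · refine (hρ.mul_const (∫ p, k p.1 * m p.2 ∂(μ.prod μ))).mono' ?_ ?_
      · exact hmfg.norm.stronglyMeasurable.integral_prod_right'.aestronglyMeasurable
      · filter_upwards [hslice] with x hx
        rw [Real.norm_of_nonneg (integral_nonneg fun _ => norm_nonneg _), ← integral_const_mul]
        refine integral_mono_of_nonneg (Eventually.of_forall fun _ => norm_nonneg _)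
          ((hk.mul_prod hm).const_mul _) hx
  refine ⟨hi.integral_prod_right, ?_⟩
  rw [← integral_integral_swap hi]
  exact integral_congr_ae (Eventually.of_forall fun x => (integral_prod_mul _ _).symm)

namespace Complex
variable {j l n : ℕ} {x s t r : ℝ}

lemma measurable_joukowskiHalfDeriv (n : ℕ) : Measurable (joukowskiHalfDeriv n) :=
  ((measurable_rpow_mul_joukowskiInvPowDeriv n).stronglyMeasurable.integral_prod_right'
    (ν := volume.restrict (Set.Ioi 0))).measurable.const_mul _

lemma integrable_rpow_mul_rpow {p q : ℝ} (h1 : 1 / 2 < p + q) (h2 : p + q < 1) (hp : 0 < p) :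
    Integrable fun x : ℝ => |x ^ 2 - 1| ^ (-p) * |x ^ 2 - 1| ^ (-q) := by
  refine (integrable_abs_sq_sub_one_rpow h1 h2).congr (Eventually.of_forall fun x => ?_)
  simp only
  rcases (abs_nonneg (x ^ 2 - 1)).eq_or_lt with h | h
  · rw [← h, Real.zero_rpow (by linarith), Real.zero_rpow (by linarith), zero_mul]
  · rw [← Real.rpow_add h]; ring_nf

lemma memLp_joukowskiHalfDeriv (hn : 1 ≤ n) : MemLp (joukowskiHalfDeriv n) 2 := by
  rw [memLp_two_iff_integrable_sq_norm (measurable_joukowskiHalfDeriv n).aestronglyMeasurable]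
  set K := ∫ t in Set.Ioi (0 : ℝ), t ^ (-1 / 2 : ℝ) * verticalDecay t with hK
  set A := ‖-I / (√Real.pi : ℝ)‖ with hA
  refine ((integrable_rpow_mul_rpow (p := 3 / 8) (q := 3 / 8) (by norm_num) (by norm_num)
    (by norm_num)).const_mul ((A * (n * K)) ^ 2)).mono'
    ((measurable_joukowskiHalfDeriv n).norm.pow_const 2).aestronglyMeasurable ?_
  filter_upwards [ae_sq_ne_one] with x hx
  have h : ‖joukowskiHalfDeriv n x‖ ≤ A * (n * |x ^ 2 - 1| ^ (-(3 / 8) : ℝ) * K) := by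
    rw [joukowskiHalfDeriv, norm_mul, hK, ← integral_const_mul]
    gcongr
    refine norm_integral_le_of_norm_le (integrableOn_rpow_mul_verticalDecay.const_mul _) ?_
    filter_upwards [ae_restrict_mem measurableSet_Ioi] with t ht
    exact norm_rpow_mul_joukowskiInvPowDeriv_le hn hx ht
  rw [Real.norm_of_nonneg (by positivity)]
  calc _ ≤ (A * (n * |x ^ 2 - 1| ^ (-(3 / 8) : ℝ) * K)) ^ 2 := by gcongr
    _ = _ := by ring

/-- Products of derivatives along two horizontal lines are dominated by an integrable function. -/
lemma norm_mul_joukowskiInvPowDeriv_le (hj : 1 ≤ j) (hl : 1 ≤ l) (hx : x ^ 2 ≠ 1) (hs : 0 < s)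
    (ht : 0 < t) :
    ‖joukowskiInvPowDeriv j (x + s * I)‖ * ‖joukowskiInvPowDeriv l (x + t * I)‖ ≤
      j * l * (verticalDecay s * verticalDecay t) *
        (|x ^ 2 - 1| ^ (-(3 / 8) : ℝ) * |x ^ 2 - 1| ^ (-(3 / 8) : ℝ)) := by
  calc _ ≤ (j * |x ^ 2 - 1| ^ (-(3 / 8) : ℝ) * verticalDecay s) *
        (l * |x ^ 2 - 1| ^ (-(3 / 8) : ℝ) * verticalDecay t) :=
      mul_le_mul (norm_joukowskiInvPowDeriv_le hj hx hs) (norm_joukowskiInvPowDeriv_le hl hx ht)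
        (norm_nonneg _) ((norm_nonneg _).trans (norm_joukowskiInvPowDeriv_le hj hx hs))
    _ = _ := by ring

lemma integrable_mul_joukowskiInvPowDeriv (hj : 1 ≤ j) (hl : 1 ≤ l) (hs : 0 < s) (ht : 0 < t)
    {ι : ℂ → ℂ} (hι : Measurable ι) (hι' : ∀ z, ‖ι z‖ = ‖z‖) :
    Integrable fun x : ℝ =>
      joukowskiInvPowDeriv j (x + s * I) * ι (joukowskiInvPowDeriv l (x + t * I)) := by
  refine ((integrable_rpow_mul_rpow (p := 3 / 8) (q := 3 / 8) (by norm_num) (by norm_num)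
    (by norm_num)).const_mul (j * l * (verticalDecay s * verticalDecay t))).mono'
    ?_ ?_
  · exact (((measurable_joukowskiInvPowDeriv j).comp (by fun_prop)).mul
      (hι.comp ((measurable_joukowskiInvPowDeriv l).comp (by fun_prop)))).aestronglyMeasurable
  · filter_upwards [ae_sq_ne_one] with x hx
    rw [norm_mul, hι']
    exact norm_mul_joukowskiInvPowDeriv_le hj hl hx hs ht

lemma differentiableAt_joukowskiInvPowDeriv_of_im_pos (n : ℕ) {z : ℂ} (hz : 0 < z.im) :
    DifferentiableAt ℂ (joukowskiInvPowDeriv n) z := by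
  refine differentiableAt_joukowskiInvPowDeriv n hz.le ?_ ?_
  · rintro rfl; simp at hz
  · rintro rfl; simp at hz

lemma differentiableAt_joukowskiInvPowDeriv_add (n : ℕ) {z : ℂ} (hz : 0 < z.im + s) :
    DifferentiableAt ℂ (fun w => joukowskiInvPowDeriv n (w + s * I)) z := by
  have h : DifferentiableAt ℂ (joukowskiInvPowDeriv n) (z + s * I) :=
    differentiableAt_joukowskiInvPowDeriv_of_im_pos n (by simpa using hz)
  exact DifferentiableAt.comp (f := fun w : ℂ => w + s * I) z h (by fun_prop)

lemma eventually_sq_ne_one_cocompact : ∀ᶠ x : ℝ in cocompact ℝ, x ^ 2 ≠ 1 := by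
  filter_upwards [(tendsto_norm_cocompact_atTop (E := ℝ)).eventually_gt_atTop 1] with x hx
  have := (one_lt_sq_iff_one_lt_abs x).2 hx
  exact this.ne'

lemma tendsto_const_mul_rpow_cocompact (c : ℝ) :
    Tendsto (fun x : ℝ => c * (|x ^ 2 - 1| ^ (-(3 / 8) : ℝ) * |x ^ 2 - 1| ^ (-(3 / 8) : ℝ)))
      (cocompact ℝ) (𝓝 0) := by
  have h := tendsto_abs_sq_sub_one_rpow (p := 3 / 8) (by norm_num)
  simpa using (h.mul h).const_mul c

/-- The derivatives lie in a Hardy space, so the bilinear pairing of two of them vanishes: the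
common line of integration can be pushed up to infinity. -/
theorem integral_joukowskiInvPowDeriv_mul (hj : 1 ≤ j) (hl : 1 ≤ l) (hs : 0 < s) (ht : 0 < t) :
    ∫ x : ℝ, joukowskiInvPowDeriv j (x + s * I) * joukowskiInvPowDeriv l (x + t * I) = 0 := by
  set H : ℂ → ℂ := fun z => joukowskiInvPowDeriv j (z + s * I) * joukowskiInvPowDeriv l (z + t * I)
    with hH
  have hline : ∀ x y : ℝ, H (x + y * I) = joukowskiInvPowDeriv j (x + (s + y : ℝ) * I) *
      joukowskiInvPowDeriv l (x + (t + y : ℝ) * I) := fun x y => by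
    simp only [hH]; push_cast; ring_nf
  have hd : DifferentiableOn ℂ H {z | 0 ≤ z.im} := by
    intro z hz
    have hz' : 0 ≤ z.im := hz
    refine DifferentiableAt.differentiableWithinAt (DifferentiableAt.mul ?_ ?_)
    · exact differentiableAt_joukowskiInvPowDeriv_add j (by linarith)
    · exact differentiableAt_joukowskiInvPowDeriv_add l (by linarith)
  have hint : ∀ y : ℝ, 0 ≤ y → Integrable fun x : ℝ => H (x + y * I) := fun y hy => by
    simp_rw [hline]
    exact integrable_mul_joukowskiInvPowDeriv hj hl (by linarith) (by linarith)
      (ι := fun z => z) measurable_id fun _ => rfl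
  have hbound : ∀ x y : ℝ, x ^ 2 ≠ 1 → 0 ≤ y → ‖H (x + y * I)‖ ≤
      j * l * (verticalDecay (s + y) * verticalDecay (t + y)) *
        (|x ^ 2 - 1| ^ (-(3 / 8) : ℝ) * |x ^ 2 - 1| ^ (-(3 / 8) : ℝ)) := fun x y hx hy => by
    rw [hline, norm_mul]
    exact norm_mul_joukowskiInvPowDeriv_le hj hl hx (by linarith) (by linarith)
  have hconst : ∀ y : ℝ, 0 ≤ y → ∫ x : ℝ, H (x + y * I) = ∫ x : ℝ, H (x + (0 : ℝ) * I) := by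
    intro y hy
    refine (integral_horizontal_line_eq hy (φ := fun x => j * l * (verticalDecay s *
      verticalDecay t) * (|x ^ 2 - 1| ^ (-(3 / 8) : ℝ) * |x ^ 2 - 1| ^ (-(3 / 8) : ℝ)))
      (hd.continuousOn.mono fun z hz => hz.1) (hd.mono fun z hz => le_of_lt hz.1) ?_
      (tendsto_const_mul_rpow_cocompact _) (hint 0 le_rfl) (hint y hy)).symm
    filter_upwards [eventually_sq_ne_one_cocompact] with x hx y' hy'
    refine (hbound x y' hx hy'.1).trans ?_
    have h1 : verticalDecay (s + y') ≤ verticalDecay s :=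
      antitoneOn_verticalDecay hs (show 0 < s + y' by linarith [hy'.1]) (by linarith [hy'.1])
    have h2 : verticalDecay (t + y') ≤ verticalDecay t :=
      antitoneOn_verticalDecay ht (show 0 < t + y' by linarith [hy'.1]) (by linarith [hy'.1])
    have h3 : 0 ≤ verticalDecay (t + y') := verticalDecay_nonneg (by linarith [hy'.1])
    have h4 := verticalDecay_nonneg hs
    gcongr
  set K := ∫ x : ℝ, |x ^ 2 - 1| ^ (-(3 / 8) : ℝ) * |x ^ 2 - 1| ^ (-(3 / 8) : ℝ)
  have hlim : Tendsto (fun y : ℝ => ∫ x : ℝ, H (x + y * I)) atTop (𝓝 0) := by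
    have h0 : Tendsto (fun y => j * l * (verticalDecay (s + y) * verticalDecay (t + y)) * K)
        atTop (𝓝 0) := by
      have h1 := tendsto_verticalDecay.comp (tendsto_atTop_add_const_left atTop s tendsto_id)
      have h2 := tendsto_verticalDecay.comp (tendsto_atTop_add_const_left atTop t tendsto_id)
      simpa using ((h1.mul h2).const_mul (j * l : ℝ)).mul_const K
    refine squeeze_zero_norm' ?_ h0
    filter_upwards [eventually_ge_atTop 0] with y hy
    rw [← integral_const_mul]
    refine norm_integral_le_of_norm_le ((integrable_rpow_mul_rpow (by norm_num) (by norm_num)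
      (by norm_num)).const_mul _) ?_
    filter_upwards [ae_sq_ne_one] with x hx using hbound x y hx hy
  have h0 : ∫ x : ℝ, H (x + (0 : ℝ) * I) = 0 := by
    refine tendsto_nhds_unique (tendsto_const_nhds.congr' ?_) hlim
    filter_upwards [eventually_ge_atTop 0] with y hy using (hconst y hy).symm
  simpa [hline] using h0

/-- The pairing of the boundary values of one derivative with another derivative on the line at
height `r`. -/
def joukowskiPairing (j l : ℕ) (r : ℝ) : ℂ :=
  ∫ x : ℝ, joukowskiInvPowDeriv j x *
    (starRingEnd ℂ) (joukowskiInvPowDeriv l (x + r * I))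

/-- The sesquilinear pairing on the lines at heights `s` and `t` depends on `s + t` only: with
`r = s + t`, the integrand on the line at height `y` is the restriction of a function that is
holomorphic in the strip `0 < Im z < r`. -/
theorem integral_joukowskiInvPowDeriv_mul_conj (hj : 1 ≤ j) (hl : 1 ≤ l) (hs : 0 < s)
    (ht : 0 < t) :
    ∫ x : ℝ, joukowskiInvPowDeriv j (x + s * I) *
      (starRingEnd ℂ) (joukowskiInvPowDeriv l (x + t * I)) = joukowskiPairing j l (s + t) := by
  obtain ⟨r, hr⟩ : ∃ r, r = s + t := ⟨_, rfl⟩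
  set H : ℂ → ℂ := fun z => joukowskiInvPowDeriv j z *
    (starRingEnd ℂ) (joukowskiInvPowDeriv l ((starRingEnd ℂ) z + r * I)) with hH
  have hline : ∀ x y : ℝ, H (x + y * I) = joukowskiInvPowDeriv j (x + y * I) *
      (starRingEnd ℂ) (joukowskiInvPowDeriv l (x + (r - y : ℝ) * I)) := fun x y => by
    simp only [hH, map_add, map_mul, conj_ofReal, conj_I]; push_cast; ring_nf
  have hd : DifferentiableOn ℂ H {z | 0 < z.im ∧ z.im < r} := by
    intro z hz
    refine DifferentiableAt.differentiableWithinAt (DifferentiableAt.mul ?_ ?_)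
    · exact differentiableAt_joukowskiInvPowDeriv_of_im_pos j hz.1
    · have h : DifferentiableAt ℂ (fun w => joukowskiInvPowDeriv l (w + r * I))
          ((starRingEnd ℂ) z) :=
        differentiableAt_joukowskiInvPowDeriv_add l (by rw [conj_im]; linarith [hz.2])
      simpa [Function.comp_def] using h.conj_conj
  have hint : ∀ y : ℝ, 0 < y → y < r → Integrable fun x : ℝ => H (x + y * I) := fun y h0 h1 => by
    simp_rw [hline]
    exact integrable_mul_joukowskiInvPowDeriv hj hl h0 (by linarith) (by fun_prop) (by simp)
  have hconst : ∀ y : ℝ, 0 < y → y ≤ s → ∫ x : ℝ, H (x + y * I) = ∫ x : ℝ, H (x + s * I) := by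
    intro y h0 h1
    refine integral_horizontal_line_eq h1 (φ := fun x => j * l * (verticalDecay y *
      verticalDecay t) * (|x ^ 2 - 1| ^ (-(3 / 8) : ℝ) * |x ^ 2 - 1| ^ (-(3 / 8) : ℝ)))
      (hd.continuousOn.mono fun z hz => ⟨h0.trans_le hz.1, hz.2.trans_lt (by linarith)⟩)
      (hd.mono fun z hz => ⟨h0.trans hz.1, hz.2.trans (by linarith)⟩) ?_
      (tendsto_const_mul_rpow_cocompact _) (hint y h0 (by linarith)) (hint s hs (by linarith))
    filter_upwards [eventually_sq_ne_one_cocompact] with x hx y' hy'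
    have hy0 : 0 < y' := h0.trans_le hy'.1
    have hy1 : 0 < r - y' := by linarith [hy'.2]
    rw [hline, norm_mul, norm_conj]
    refine (norm_mul_joukowskiInvPowDeriv_le hj hl hx hy0 hy1).trans ?_
    have h2 : verticalDecay y' ≤ verticalDecay y := antitoneOn_verticalDecay h0 hy0 hy'.1
    have h3 : verticalDecay (r - y') ≤ verticalDecay t :=
      antitoneOn_verticalDecay ht hy1 (by linarith [hy'.2])
    have h4 := verticalDecay_nonneg hy1
    have h5 := verticalDecay_nonneg h0
    gcongr
  have hlim : Tendsto (fun y : ℝ => ∫ x : ℝ, H (x + y * I)) (𝓝[>] 0)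
      (𝓝 (joukowskiPairing j l r)) := by
    -- For `y < s` the height `r - y` exceeds `t`, which keeps the second factor bounded by its
    -- majorant at height `t`; the first factor is bounded uniformly up to the real line.
    refine tendsto_integral_filter_of_dominated_convergence
      (fun x => j * l * verticalDecay t *
        (|x ^ 2 - 1| ^ (-(1 / 2) : ℝ) * |x ^ 2 - 1| ^ (-(3 / 8) : ℝ))) ?_ ?_ ?_ ?_
    · filter_upwards [Ioo_mem_nhdsGT hs] with y hy
      exact (hint y hy.1 (by linarith [hy.2])).aestronglyMeasurable
    · filter_upwards [Ioo_mem_nhdsGT hs] with y hy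
      filter_upwards [ae_sq_ne_one] with x hx
      have hy1 : 0 < r - y := by linarith [hy.2]
      rw [hline, norm_mul, norm_conj]
      have h1 := norm_joukowskiInvPowDeriv_le_rpow (n := j) hx hy.1.le
      have h2 := norm_joukowskiInvPowDeriv_le hl hx hy1
      have h3 : verticalDecay (r - y) ≤ verticalDecay t :=
        antitoneOn_verticalDecay ht hy1 (by linarith [hy.2])
      calc _ ≤ (j * |x ^ 2 - 1| ^ (-(1 / 2) : ℝ)) *
            (l * |x ^ 2 - 1| ^ (-(3 / 8) : ℝ) * verticalDecay t) := by
            refine mul_le_mul h1 (h2.trans ?_) (norm_nonneg _) (by positivity)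
            gcongr
        _ = _ := by ring
    · exact (integrable_rpow_mul_rpow (by norm_num) (by norm_num) (by norm_num)).const_mul _
    · filter_upwards [ae_sq_ne_one] with x hx
      have hr0 : 0 < r := by linarith
      have hc1 : ContinuousAt (joukowskiInvPowDeriv j) (x + (0 : ℝ) * I) :=
        (differentiableAt_joukowskiInvPowDeriv j (by simp) (add_mul_I_ne_one hx)
          (add_mul_I_ne_neg_one hx)).continuousAt
      have hc2 : ContinuousAt (joukowskiInvPowDeriv l) (x + (r - 0 : ℝ) * I) :=
        (differentiableAt_joukowskiInvPowDeriv_of_im_pos l (by simpa using hr0)).continuousAt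
      have hcont : ContinuousAt (fun y : ℝ => joukowskiInvPowDeriv j (x + y * I) *
          (starRingEnd ℂ) (joukowskiInvPowDeriv l (x + (r - y : ℝ) * I))) 0 := by
        refine ContinuousAt.mul ?_ (continuous_conj.continuousAt.comp ?_)
        · exact ContinuousAt.comp (f := fun y : ℝ => (x + y * I : ℂ)) hc1 (by fun_prop)
        · exact ContinuousAt.comp (f := fun y : ℝ => (x + (r - y : ℝ) * I : ℂ)) hc2 (by fun_prop)
      have := hcont.tendsto.mono_left (nhdsWithin_le_nhds (s := Set.Ioi 0))
      simpa [hline] using this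
  have h0 : ∫ x : ℝ, H (x + s * I) = joukowskiPairing j l r := by
    refine tendsto_nhds_unique (tendsto_const_nhds.congr' ?_) hlim
    filter_upwards [Ioo_mem_nhdsGT hs] with y hy using (hconst y hy.1 hy.2.le).symm
  rw [← hr, ← h0]
  simp_rw [hline, hr, add_sub_cancel_left]

end Complex

/-! ### The Dirichlet pairing and the beta integral -/

lemma setIntegral_rpow_mul_sub_rpow {r : ℝ} (hr : 0 < r) :
    ∫ s in Set.Ioc 0 r, ((s ^ (-1 / 2 : ℝ) : ℝ) : ℂ) * (((r - s) ^ (-1 / 2 : ℝ) : ℝ) : ℂ) =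
      Real.pi := by
  have hb : Complex.betaIntegral (1 / 2) (1 / 2) = Real.pi := by
    have h := Complex.Gamma_mul_Gamma_eq_betaIntegral (s := 1 / 2) (t := 1 / 2) (by norm_num)
      (by norm_num)
    rw [Complex.Gamma_one_half_eq, add_halves, Complex.Gamma_one, one_mul,
      ← Complex.cpow_add _ _ (by exact_mod_cast Real.pi_ne_zero), add_halves,
      Complex.cpow_one] at h
    exact h.symm
  have h := Complex.betaIntegral_scaled (1 / 2) (1 / 2) hr
  rw [hb, add_halves, sub_self, Complex.cpow_zero, one_mul,
    intervalIntegral.integral_of_le hr.le] at h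
  rw [← h]
  refine setIntegral_congr_fun measurableSet_Ioc fun s hs => ?_
  have e : ((-1 / 2 : ℝ) : ℂ) = 1 / 2 - 1 := by push_cast; norm_num
  rw [Complex.ofReal_cpow hs.1.le, Complex.ofReal_cpow (by linarith [hs.2]), e, Complex.ofReal_sub]

/-- Integrating a function of `s + t` over the quadrant against `(s t) ^ (-1/2)`; the constant is
the beta integral `B(1/2, 1/2) = π`. -/
lemma integral_quadrant_rpow_mul_add {Φ : ℝ → ℂ}
    (hi : IntegrableOn (fun p : ℝ × ℝ => ((p.1 ^ (-1 / 2 : ℝ) : ℝ) : ℂ) *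
      ((p.2 ^ (-1 / 2 : ℝ) : ℝ) : ℂ) * Φ (p.1 + p.2)) (Set.Ioi 0 ×ˢ Set.Ioi 0)
      (volume.prod volume)) :
    ∫ p in Set.Ioi (0 : ℝ) ×ˢ Set.Ioi (0 : ℝ), ((p.1 ^ (-1 / 2 : ℝ) : ℝ) : ℂ) *
      ((p.2 ^ (-1 / 2 : ℝ) : ℝ) : ℂ) * Φ (p.1 + p.2) ∂(volume.prod volume) =
      Real.pi * ∫ r in Set.Ioi 0, Φ r := by
  have hms : MeasurableSet (Set.Ioi (0 : ℝ) ×ˢ Set.Ioi (0 : ℝ)) :=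
    measurableSet_Ioi.prod measurableSet_Ioi
  set g : ℝ × ℝ → ℂ := (Set.Ioi (0 : ℝ) ×ˢ Set.Ioi (0 : ℝ)).indicator fun p =>
    ((p.1 ^ (-1 / 2 : ℝ) : ℝ) : ℂ) * ((p.2 ^ (-1 / 2 : ℝ) : ℝ) : ℂ) * Φ (p.1 + p.2) with hg
  have hgi : Integrable g (volume.prod volume) := (integrable_indicator_iff hms).2 hi
  have hmp := measurePreserving_prod_neg_add (volume : Measure ℝ) (volume : Measure ℝ)
  have hemb : MeasurableEmbedding fun z : ℝ × ℝ => (z.1, -z.1 + z.2) :=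
    (MeasurableEquiv.shearAddRight ℝ).symm.measurableEmbedding
  have hgi' : Integrable (fun z : ℝ × ℝ => g (z.1, -z.1 + z.2)) (volume.prod volume) :=
    (hmp.integrable_comp_emb hemb).2 hgi
  rw [← integral_indicator hms, ← hg, ← hmp.integral_comp hemb, integral_prod_symm _ hgi',
    ← integral_const_mul, ← integral_indicator measurableSet_Ioi]
  congr 1
  ext r
  by_cases hr : 0 < r
  · rw [Set.indicator_of_mem (by exact hr), ← setIntegral_rpow_mul_sub_rpow hr,
      integral_Ioc_eq_integral_Ioo, ← integral_mul_const, ← integral_indicator measurableSet_Ioo]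
    congr 1
    ext s
    by_cases hs : s ∈ Set.Ioo 0 r
    · rw [Set.indicator_of_mem hs, hg, Set.indicator_of_mem
        (by exact ⟨hs.1, by show 0 < -s + r; linarith [hs.2]⟩)]
      simp only
      rw [show s + (-s + r) = r by ring, show -s + r = r - s by ring]
    · rw [Set.indicator_of_notMem hs, hg, Set.indicator_of_notMem]
      rintro ⟨h1, h2⟩
      have h1' : 0 < s := h1
      have h2' : 0 < -s + r := h2
      exact hs ⟨h1', by linarith⟩
  · rw [Set.indicator_of_notMem (by exact hr)]
    have : ∀ s : ℝ, g (s, -s + r) = 0 := fun s => by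
      rw [hg, Set.indicator_of_notMem]
      rintro ⟨h1, h2⟩
      have h1' : 0 < s := h1
      have h2' : 0 < -s + r := h2
      exact hr (by linarith)
    simp [this]

namespace Complex
variable {j l n : ℕ} {x s t r : ℝ}

lemma tendsto_joukowskiInv_pow_vertical (hn : 1 ≤ n) (x : ℝ) :
    Tendsto (fun t : ℝ => joukowskiInv (x + t * I) ^ n) atTop (𝓝 0) := by
  refine squeeze_zero_norm' ?_ tendsto_inv_atTop_zero
  filter_upwards [eventually_gt_atTop 0] with t ht
  have him : 0 ≤ (x + t * I : ℂ).im := by simpa using ht.le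
  have h := norm_joukowskiInv_mul_norm_le_one him
  have h1 := abs_im_le_norm (x + t * I : ℂ)
  simp [abs_of_pos ht] at h1
  rw [norm_pow]
  refine (pow_le_of_le_one (norm_nonneg _) (norm_joukowskiInv_le_one him) (by omega)).trans ?_
  rw [← one_div, le_div_iff₀ ht]
  exact (mul_le_mul_of_nonneg_left h1 (norm_nonneg _)).trans h

lemma integrableOn_joukowskiInvPowDeriv_vertical (hn : 1 ≤ n) (hx : x ^ 2 ≠ 1) :
    IntegrableOn (fun t : ℝ => joukowskiInvPowDeriv n (x + t * I)) (Set.Ioi 0) := by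
  refine (integrableOn_verticalDecay.const_mul (n * |x ^ 2 - 1| ^ (-(3 / 8) : ℝ))).mono' ?_ ?_
  · exact ((measurable_joukowskiInvPowDeriv_vertical n).comp
      measurable_prodMk_left).aestronglyMeasurable
  · filter_upwards [ae_restrict_mem measurableSet_Ioi] with t ht
    exact norm_joukowskiInvPowDeriv_le hn hx ht

lemma integral_joukowskiInvPowDeriv_vertical (hn : 1 ≤ n) (hx : x ^ 2 ≠ 1) :
    ∫ t in Set.Ioi (0 : ℝ), joukowskiInvPowDeriv n (x + t * I) = I * joukowskiInv x ^ n := by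
  have h := integral_Ioi_of_hasDerivAt_of_tendsto' (a := 0)
    (fun t ht => hasDerivAt_joukowskiInv_pow_vertical (n := n) hx ht)
    (Integrable.const_mul (integrableOn_joukowskiInvPowDeriv_vertical hn hx) I)
    (tendsto_joukowskiInv_pow_vertical hn x)
  rw [integral_const_mul, ofReal_zero, zero_mul, add_zero] at h
  linear_combination (-I) * h + (∫ t in Set.Ioi (0 : ℝ), joukowskiInvPowDeriv n (x + t * I)) * I_sq

/-- Fubini, with the vertical integral of the second derivative computed by the fundamental theorem
of calculus. -/
lemma integrable_and_integral_joukowskiPairing (hj : 1 ≤ j) (hl : 1 ≤ l) :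
    Integrable (fun x : ℝ => joukowskiInvPowDeriv j x *
      (starRingEnd ℂ) (I * joukowskiInv x ^ l)) ∧
    ∫ r in Set.Ioi 0, joukowskiPairing j l r =
      ∫ x : ℝ, joukowskiInvPowDeriv j x * (starRingEnd ℂ) (I * joukowskiInv x ^ l) := by
  have hi : Integrable (fun q : ℝ × ℝ => joukowskiInvPowDeriv j q.1 *
      (starRingEnd ℂ) (joukowskiInvPowDeriv l (q.1 + q.2 * I)))
      (volume.prod (volume.restrict (Set.Ioi 0))) := by
    have hmaj : Integrable (fun q : ℝ × ℝ => ((j : ℝ) * l *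
        (|q.1 ^ 2 - 1| ^ (-(1 / 2) : ℝ) * |q.1 ^ 2 - 1| ^ (-(3 / 8) : ℝ))) * verticalDecay q.2)
        (volume.prod (volume.restrict (Set.Ioi 0))) :=
      Integrable.mul_prod (f := fun x : ℝ => (j : ℝ) * l *
        (|x ^ 2 - 1| ^ (-(1 / 2) : ℝ) * |x ^ 2 - 1| ^ (-(3 / 8) : ℝ)))
        ((integrable_rpow_mul_rpow (by norm_num) (by norm_num) (by norm_num)).const_mul _)
        integrableOn_verticalDecay
    refine hmaj.mono' ?_ ?_
    · exact (((measurable_joukowskiInvPowDeriv j).comp (by fun_prop)).mul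
        (continuous_conj.measurable.comp
          (measurable_joukowskiInvPowDeriv_vertical l))).aestronglyMeasurable
    · filter_upwards [Measure.quasiMeasurePreserving_fst.ae ae_sq_ne_one,
        Measure.quasiMeasurePreserving_snd.ae (ae_restrict_mem measurableSet_Ioi)] with q h1 h2
      rw [norm_mul, norm_conj]
      have h3 : ‖joukowskiInvPowDeriv j q.1‖ ≤ j * |q.1 ^ 2 - 1| ^ (-(1 / 2) : ℝ) := by
        simpa using norm_joukowskiInvPowDeriv_le_rpow (n := j) (t := 0) h1 le_rfl
      calc _ ≤ (j * |q.1 ^ 2 - 1| ^ (-(1 / 2) : ℝ)) *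
            (l * |q.1 ^ 2 - 1| ^ (-(3 / 8) : ℝ) * verticalDecay q.2) :=
            mul_le_mul h3 (norm_joukowskiInvPowDeriv_le hl h1 h2) (norm_nonneg _) (by positivity)
        _ = _ := by ring
  have hae : ∀ᵐ x : ℝ, ∫ r in Set.Ioi (0 : ℝ), joukowskiInvPowDeriv j x *
      (starRingEnd ℂ) (joukowskiInvPowDeriv l (x + r * I)) =
      joukowskiInvPowDeriv j x * (starRingEnd ℂ) (I * joukowskiInv x ^ l) := by
    filter_upwards [ae_sq_ne_one] with x hx
    rw [integral_const_mul, integral_conj, integral_joukowskiInvPowDeriv_vertical hl hx]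
  refine ⟨hi.integral_prod_left.congr hae, ?_⟩
  rw [← integral_congr_ae hae]
  exact (integral_integral_swap hi).symm

/-- On `(-1,1)` the derivative is `i j w ^ j / √(1 - x²)` with `w` on the unit circle, elsewhere the
integrand is purely imaginary. -/
lemma re_joukowskiInvPowDeriv_mul_conj (hx : x ^ 2 ≠ 1) :
    (joukowskiInvPowDeriv j x * (starRingEnd ℂ) (I * joukowskiInv x ^ l)).re =
      (Set.Ioc (-1 : ℝ) 1).indicator (fun x => j *
        ((Polynomial.Chebyshev.T ℝ ((j : ℤ) - l)).eval x * √(1 - x ^ 2)⁻¹)) x := by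
  rcases lt_or_gt_of_ne hx with h | h
  · have hx1 : |x| < 1 := (sq_lt_one_iff_abs_lt_one x).1 h
    obtain ⟨h1, h2⟩ := abs_lt.1 hx1
    rw [Set.indicator_of_mem (by exact ⟨h1, h2.le⟩), joukowskiInvPowDeriv,
      joukowskiRoot_ofReal_of_abs_le_one hx1.le, Real.sqrt_inv]
    set R := √(1 - x ^ 2)
    obtain ⟨θ, ⟨h0, hπ⟩, rfl⟩ : ∃ θ ∈ Set.Icc 0 Real.pi, Real.cos θ = x :=
      ⟨Real.arccos x, ⟨Real.arccos_nonneg x, Real.arccos_le_pi x⟩, Real.cos_arccos h1.le h2.le⟩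
    rw [joukowskiInv_cos h0 hπ, Polynomial.Chebyshev.T_real_cos, map_mul, conj_I, map_pow,
      ← exp_conj]
    have e : (starRingEnd ℂ) (-(θ * I)) = θ * I := by simp
    rw [e, ← exp_nat_mul, ← exp_nat_mul]
    have e2 : I * j * exp (j * -(θ * I)) / R * (-I * exp (l * (θ * I))) =
        ((j * R⁻¹ : ℝ) : ℂ) * exp (((-((j - l) * θ) : ℝ) : ℂ) * I) := by
      rw [show (((-((j - l) * θ) : ℝ) : ℂ) * I) = j * -(θ * I) + l * (θ * I) by push_cast; ring,
        exp_add]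
      push_cast
      linear_combination (-(j * exp (j * -(θ * I)) * exp (l * (θ * I)) * (R : ℂ)⁻¹)) * I_sq
    rw [e2, re_ofReal_mul, exp_ofReal_mul_I_re, Real.cos_neg]
    push_cast
    ring
  · have hx1 : 1 < |x| := (one_lt_sq_iff_one_lt_abs x).1 h
    rw [Set.indicator_of_notMem (by
      rintro ⟨h1, h2⟩; exact absurd (abs_le.2 ⟨h1.le, h2⟩) hx1.not_ge)]
    obtain ⟨a, b, ha, hb⟩ : ∃ a b : ℝ, joukowskiInv x = a ∧ joukowskiRoot x = I * b := by
      rcases lt_abs.1 hx1 with h' | h'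
      · refine ⟨x - √(x ^ 2 - 1), -√(x ^ 2 - 1), ?_, ?_⟩
        · rw [joukowskiInv, joukowskiRoot_ofReal_of_one_le h'.le]
          push_cast
          linear_combination (√(x ^ 2 - 1) : ℂ) * I_sq
        · rw [joukowskiRoot_ofReal_of_one_le h'.le]; push_cast; ring
      · refine ⟨x + √(x ^ 2 - 1), √(x ^ 2 - 1), ?_, ?_⟩
        · rw [joukowskiInv, joukowskiRoot_ofReal_of_le_neg_one (by linarith)]
          push_cast
          linear_combination -(√(x ^ 2 - 1) : ℂ) * I_sq
        · rw [joukowskiRoot_ofReal_of_le_neg_one (by linarith)]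
    rw [joukowskiInvPowDeriv, ha, hb, mul_assoc, mul_div_mul_left _ _ I_ne_zero, map_mul, conj_I,
      ← ofReal_pow, ← ofReal_pow, conj_ofReal]
    rw [show (j : ℂ) * (a ^ j : ℝ) / b * (-I * (a ^ l : ℝ)) =
      ((j * a ^ j / b * a ^ l : ℝ) : ℂ) * (-I) by push_cast; ring, re_ofReal_mul]
    simp

/-- The pairing of the derivatives integrates to the Dirichlet pairing of the powers, which
reduces to the orthogonality of the Chebyshev polynomials on `(-1,1)`. -/
theorem re_integral_joukowskiPairing (hj : 1 ≤ j) (hl : 1 ≤ l) :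
    (∫ r in Set.Ioi 0, joukowskiPairing j l r).re = if j = l then l * Real.pi else 0 := by
  obtain ⟨hi, he⟩ := integrable_and_integral_joukowskiPairing hj hl
  have hre := reCLM.integral_comp_comm hi
  simp only [reCLM_apply] at hre
  rw [he, ← hre, integral_congr_ae (ae_sq_ne_one.mono fun x hx =>
    re_joukowskiInvPowDeriv_mul_conj (j := j) (l := l) hx), integral_indicator measurableSet_Ioc,
    integral_const_mul, ← intervalIntegral.integral_of_le (by norm_num),
    ← Polynomial.Chebyshev.integral_measureT]
  split_ifs with h
  · rw [h, sub_self, Polynomial.Chebyshev.integral_eval_T_real_measureT_zero]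
  · rw [Polynomial.Chebyshev.integral_eval_T_real_measureT_of_ne_zero
      (sub_ne_zero.2 (by exact_mod_cast h)), mul_zero]

end Complex

/-! ### Pairings of half-derivatives -/

namespace Complex
variable {j l n : ℕ} {x : ℝ}

/-- Fubini for a pairing of half-derivatives: it is a double integral of pairings of derivatives on
two horizontal lines. The map `ι` is the identity for the bilinear pairing and complex conjugation
for the sesquilinear one. -/
lemma integral_joukowskiHalfDeriv_mul (hj : 1 ≤ j) (hl : 1 ≤ l) {ι : ℂ → ℂ} (hι : Measurable ι)
    (hι' : ∀ z, ‖ι z‖ = ‖z‖) (hmul : ∀ (a : ℝ) (z : ℂ), ι (a * z) = a * ι z) {Ψ : ℝ → ℝ → ℂ}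
    (hΨ : ∀ s t : ℝ, 0 < s → 0 < t → ∫ x : ℝ, joukowskiInvPowDeriv j (x + s * I) *
      ι (joukowskiInvPowDeriv l (x + t * I)) = Ψ s t) :
    IntegrableOn (fun p : ℝ × ℝ => ((p.1 ^ (-1 / 2 : ℝ) : ℝ) : ℂ) *
      ((p.2 ^ (-1 / 2 : ℝ) : ℝ) : ℂ) * Ψ p.1 p.2) (Set.Ioi 0 ×ˢ Set.Ioi 0)
      (volume.prod volume) ∧
    ∫ x : ℝ, (∫ s in Set.Ioi (0 : ℝ),
        ((s ^ (-1 / 2 : ℝ) : ℝ) : ℂ) * joukowskiInvPowDeriv j (x + s * I)) *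
      (∫ t in Set.Ioi (0 : ℝ),
        ι (((t ^ (-1 / 2 : ℝ) : ℝ) : ℂ) * joukowskiInvPowDeriv l (x + t * I))) =
      ∫ p in Set.Ioi (0 : ℝ) ×ˢ Set.Ioi (0 : ℝ), ((p.1 ^ (-1 / 2 : ℝ) : ℝ) : ℂ) *
        ((p.2 ^ (-1 / 2 : ℝ) : ℝ) : ℂ) * Ψ p.1 p.2 ∂(volume.prod volume) := by
  have hms : MeasurableSet (Set.Ioi (0 : ℝ) ×ˢ Set.Ioi (0 : ℝ)) :=
    measurableSet_Ioi.prod measurableSet_Ioi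
  have hb : ∀ {n : ℕ}, 1 ≤ n → ∀ᵐ x : ℝ, ∀ᵐ s ∂(volume.restrict (Set.Ioi (0 : ℝ))),
      ‖((s ^ (-1 / 2 : ℝ) : ℝ) : ℂ) * joukowskiInvPowDeriv n (x + s * I)‖ ≤
        |x ^ 2 - 1| ^ (-(3 / 8) : ℝ) * (n * (s ^ (-1 / 2 : ℝ) * verticalDecay s)) := by
    intro n hn
    filter_upwards [ae_sq_ne_one] with x hx
    filter_upwards [ae_restrict_mem measurableSet_Ioi] with s hs
    refine (norm_rpow_mul_joukowskiInvPowDeriv_le hn hx hs).trans (le_of_eq ?_)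
    ring
  obtain ⟨h1, h2⟩ := integral_mul_integral_swap
    (f := fun p : ℝ × ℝ => ((p.2 ^ (-1 / 2 : ℝ) : ℝ) : ℂ) * joukowskiInvPowDeriv j (p.1 + p.2 * I))
    (g := fun p : ℝ × ℝ =>
      ι (((p.2 ^ (-1 / 2 : ℝ) : ℝ) : ℂ) * joukowskiInvPowDeriv l (p.1 + p.2 * I)))
    (measurable_rpow_mul_joukowskiInvPowDeriv j)
    (hι.comp (measurable_rpow_mul_joukowskiInvPowDeriv l))
    (μ := volume.restrict (Set.Ioi (0 : ℝ)))
    (integrable_rpow_mul_rpow (p := 3 / 8) (q := 3 / 8) (by norm_num) (by norm_num) (by norm_num))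
    (integrableOn_rpow_mul_verticalDecay.const_mul j)
    (integrableOn_rpow_mul_verticalDecay.const_mul l) (hb hj)
    (by simpa only [hι'] using hb hl)
  have hcongr : Set.EqOn (fun p : ℝ × ℝ => ∫ x : ℝ,
      ((p.1 ^ (-1 / 2 : ℝ) : ℝ) : ℂ) * joukowskiInvPowDeriv j (x + p.1 * I) *
        ι (((p.2 ^ (-1 / 2 : ℝ) : ℝ) : ℂ) * joukowskiInvPowDeriv l (x + p.2 * I)))
      (fun p : ℝ × ℝ => ((p.1 ^ (-1 / 2 : ℝ) : ℝ) : ℂ) *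
        ((p.2 ^ (-1 / 2 : ℝ) : ℝ) : ℂ) * Ψ p.1 p.2) (Set.Ioi 0 ×ˢ Set.Ioi 0) := by
    intro p hp
    simp only
    rw [← hΨ p.1 p.2 hp.1 hp.2, ← integral_const_mul]
    congr 1
    ext x
    rw [hmul]
    ring
  rw [Measure.prod_restrict] at h1 h2
  exact ⟨IntegrableOn.congr_fun h1 hcongr hms, h2.trans (setIntegral_congr_fun hms hcongr)⟩

/-- The half-derivatives lie in a Hardy space, so their bilinear pairing vanishes. -/
theorem integral_joukowskiHalfDeriv_mul_joukowskiHalfDeriv (hj : 1 ≤ j) (hl : 1 ≤ l) :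
    ∫ x : ℝ, joukowskiHalfDeriv j x * joukowskiHalfDeriv l x = 0 := by
  obtain ⟨-, h⟩ := integral_joukowskiHalfDeriv_mul hj hl (ι := fun z => z) measurable_id
    (fun _ => rfl) (fun _ _ => rfl) (Ψ := fun _ _ => 0)
    (fun s t hs ht => integral_joukowskiInvPowDeriv_mul hj hl hs ht)
  simp only [mul_zero, integral_zero] at h
  simp_rw [joukowskiHalfDeriv, mul_mul_mul_comm, integral_const_mul]
  rw [h, mul_zero]

/-- The factor `π⁻¹` from the two normalisations cancels the beta integral. -/
theorem re_integral_joukowskiHalfDeriv_mul_conj (hj : 1 ≤ j) (hl : 1 ≤ l) :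
    (∫ x : ℝ, joukowskiHalfDeriv j x * (starRingEnd ℂ) (joukowskiHalfDeriv l x)).re =
      if j = l then l * Real.pi else 0 := by
  obtain ⟨hi, h⟩ := integral_joukowskiHalfDeriv_mul hj hl (ι := starRingEnd ℂ) (by fun_prop)
    (by simp) (by simp) (Ψ := fun s t => joukowskiPairing j l (s + t))
    (fun s t hs ht => integral_joukowskiInvPowDeriv_mul_conj hj hl hs ht)
  rw [integral_quadrant_rpow_mul_add hi] at h
  have hπ : ((√Real.pi : ℝ) : ℂ) * (√Real.pi : ℝ) = Real.pi := by
    rw [← ofReal_mul, Real.mul_self_sqrt Real.pi_pos.le]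
  have hπ0 : (Real.pi : ℂ) ≠ 0 := by exact_mod_cast Real.pi_ne_zero
  have hc : -I / (√Real.pi : ℝ) * (starRingEnd ℂ) (-I / (√Real.pi : ℝ)) = (Real.pi : ℂ)⁻¹ := by
    rw [map_div₀, map_neg, conj_I, conj_ofReal, div_mul_div_comm, hπ, neg_neg, neg_mul, I_mul_I,
      neg_neg, one_div]
  have e : ∀ x : ℝ, joukowskiHalfDeriv j x * (starRingEnd ℂ) (joukowskiHalfDeriv l x) =
      (Real.pi : ℂ)⁻¹ * ((∫ s in Set.Ioi (0 : ℝ),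
        ((s ^ (-1 / 2 : ℝ) : ℝ) : ℂ) * joukowskiInvPowDeriv j (x + s * I)) *
      (∫ t in Set.Ioi (0 : ℝ), (starRingEnd ℂ)
        (((t ^ (-1 / 2 : ℝ) : ℝ) : ℂ) * joukowskiInvPowDeriv l (x + t * I)))) := fun x => by
    rw [joukowskiHalfDeriv, joukowskiHalfDeriv, map_mul, mul_mul_mul_comm, hc, integral_conj]
  simp_rw [e]
  rw [integral_const_mul, h, inv_mul_cancel_left₀ hπ0, re_integral_joukowskiPairing hj hl]

/-- The vanishing bilinear pairing makes the integrals of the products of real parts and of imaginary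
parts equal; the real part of the sesquilinear pairing is their sum. -/
theorem integral_re_mul_re_and_im_mul_im (hj : 1 ≤ j) (hl : 1 ≤ l) :
    ∫ x : ℝ, (joukowskiHalfDeriv j x).re * (joukowskiHalfDeriv l x).re =
      Real.pi / 2 * (l * if j = l then 1 else 0) ∧
    ∫ x : ℝ, (joukowskiHalfDeriv j x).im * (joukowskiHalfDeriv l x).im =
      Real.pi / 2 * (l * if j = l then 1 else 0) := by
  have mj := memLp_joukowskiHalfDeriv hj
  have ml := memLp_joukowskiHalfDeriv hl
  have irr : Integrable fun x => (joukowskiHalfDeriv j x).re * (joukowskiHalfDeriv l x).re :=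
    mj.re.integrable_mul ml.re
  have iii : Integrable fun x => (joukowskiHalfDeriv j x).im * (joukowskiHalfDeriv l x).im :=
    mj.im.integrable_mul ml.im
  have i1 : Integrable fun x => joukowskiHalfDeriv j x * joukowskiHalfDeriv l x :=
    mj.integrable_mul ml
  have i2 : Integrable fun x =>
      joukowskiHalfDeriv j x * (starRingEnd ℂ) (joukowskiHalfDeriv l x) :=
    mj.integrable_mul ml.star
  have e1 := congrArg re (integral_joukowskiHalfDeriv_mul_joukowskiHalfDeriv hj hl)
  have e2 := re_integral_joukowskiHalfDeriv_mul_conj hj hl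
  have r1 := reCLM.integral_comp_comm i1
  have r2 := reCLM.integral_comp_comm i2
  simp only [reCLM_apply] at r1 r2
  rw [← r1] at e1
  rw [← r2] at e2
  simp only [mul_re, conj_re, conj_im, zero_re] at e1 e2
  simp only [mul_neg, sub_neg_eq_add] at e2
  rw [integral_sub irr iii] at e1
  rw [integral_add irr iii] at e2
  split_ifs at e2 ⊢ <;> constructor <;> linarith

lemma fracLap_extChebyshevT (hn : 1 ≤ n) (hx : x ^ 2 ≠ 1) :
    FracLapExistsAt (1 / 4) (extChebyshevT n) x ∧
      fracLap (1 / 4) (extChebyshevT n) x = (joukowskiHalfDeriv n x).re := by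
  obtain ⟨n, rfl⟩ := Nat.exists_eq_add_of_le' hn
  refine fracLap_of_joukowskiInv_pow reCLM hn (fun y => ?_) hx
  rw [joukowskiInv_pow_ofReal]
  simp

lemma fracLap_weightedChebyshevU (n : ℕ) (hx : x ^ 2 ≠ 1) :
    FracLapExistsAt (1 / 4) (weightedChebyshevU n) x ∧
      fracLap (1 / 4) (weightedChebyshevU n) x = -(joukowskiHalfDeriv (n + 1) x).im := by
  refine fracLap_of_joukowskiInv_pow (-imCLM) (by omega) (fun y => ?_) hx
  rw [joukowskiInv_pow_ofReal]
  simp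

end Complex

lemma exists_inner_toLp_eq_integral {u v a b : ℝ → ℝ} (ha : MemLp a 2) (hb : MemLp b 2)
    (hu : u =ᵐ[volume] a) (hv : v =ᵐ[volume] b) :
    ∃ (hu : MemLp u 2 (volume : Measure ℝ)) (hv : MemLp v 2 (volume : Measure ℝ)),
      inner ℝ (hu.toLp u) (hv.toLp v) = ∫ x, a x * b x := by
  refine ⟨(memLp_congr_ae hu).2 ha, (memLp_congr_ae hv).2 hb, ?_⟩
  rw [L2.inner_def]
  refine integral_congr_ae ?_
  filter_upwards [hu, hv, ((memLp_congr_ae hu).2 ha).coeFn_toLp,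
    ((memLp_congr_ae hv).2 hb).coeFn_toLp] with x h1 h2 h3 h4
  rw [h3, h4, h1, h2]
  simp [mul_comm]

end

theorem mainTheorem7 :
    (∀ n : ℕ, 1 ≤ n → ∀ᵐ x : ℝ, FracLapExistsAt (1 / 4) (extChebyshevT n) x) ∧
    (∀ m : ℕ, ∀ᵐ x : ℝ, FracLapExistsAt (1 / 4) (weightedChebyshevU m) x) ∧
    (∀ j l : ℕ, 1 ≤ j → 1 ≤ l →
      ∃ (hj : MemLp (fracLap (1 / 4) (extChebyshevT j)) 2 (volume : Measure ℝ))
        (hl : MemLp (fracLap (1 / 4) (extChebyshevT l)) 2 (volume : Measure ℝ)),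
        inner ℝ (hj.toLp (fracLap (1 / 4) (extChebyshevT j)))
            (hl.toLp (fracLap (1 / 4) (extChebyshevT l)))
          = Real.pi / 2 * ((l : ℝ) * if j = l then 1 else 0)) ∧
    (∀ j l : ℕ,
      ∃ (hj : MemLp (fracLap (1 / 4) (weightedChebyshevU j)) 2 (volume : Measure ℝ))
        (hl : MemLp (fracLap (1 / 4) (weightedChebyshevU l)) 2 (volume : Measure ℝ)),
        inner ℝ (hj.toLp (fracLap (1 / 4) (weightedChebyshevU j)))
            (hl.toLp (fracLap (1 / 4) (weightedChebyshevU l)))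
          = Real.pi / 2 * (((l : ℝ) + 1) * if j = l then 1 else 0)) := by
  refine ⟨fun n hn => ?_, fun m => ?_, fun j l hj hl => ?_, fun j l => ?_⟩
  · filter_upwards [ae_sq_ne_one] with x hx using (Complex.fracLap_extChebyshevT hn hx).1
  · filter_upwards [ae_sq_ne_one] with x hx using (Complex.fracLap_weightedChebyshevU m hx).1
  · rw [← (Complex.integral_re_mul_re_and_im_mul_im hj hl).1]
    exact exists_inner_toLp_eq_integral (Complex.memLp_joukowskiHalfDeriv hj).re
      (Complex.memLp_joukowskiHalfDeriv hl).re
      (ae_sq_ne_one.mono fun x hx => (Complex.fracLap_extChebyshevT hj hx).2)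
      (ae_sq_ne_one.mono fun x hx => (Complex.fracLap_extChebyshevT hl hx).2)
  · have h := (Complex.integral_re_mul_re_and_im_mul_im (Nat.le_add_left 1 j)
      (Nat.le_add_left 1 l)).2
    simp only [Nat.cast_add, Nat.cast_one, add_left_inj] at h
    rw [← h]
    simp_rw [← neg_mul_neg (Complex.im (joukowskiHalfDeriv (j + 1) _))]
    exact exists_inner_toLp_eq_integral
      (Complex.memLp_joukowskiHalfDeriv (Nat.le_add_left 1 j)).im.neg
      (Complex.memLp_joukowskiHalfDeriv (Nat.le_add_left 1 l)).im.neg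
      (ae_sq_ne_one.mono fun x hx => (Complex.fracLap_weightedChebyshevU j hx).2)
      (ae_sq_ne_one.mono fun x hx => (Complex.fracLap_weightedChebyshevU l hx).2)
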